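/- **Setting.** For $g\in L^1(\mathbb R^n)$ real-valued let $\hat g(\omega)=(2\pi)^{-n}\int g(x)e^{-i\langle\omega,x\rangle}dx$; for vector-valued $g$ the Fourier transform is taken componentwise. For a bounded set $B\subseteq\mathbb R^n$ let $\|\omega\|_B=\sup_{x\in B}|\langle\omega,x\rangle|$, and let $\mathcal F_B$ be the set of $g\in L^1(\mathbb R^n)$ with $g(x)=g(0)+\int(e^{i\langle\omega,x\rangle}-1)\hat g(\omega)\,d\omega$ for all $x\in B$ (the integrand being integrable). A function $f$ is *$C$-Barron on $B$*, $f\in\Gamma_B(C)$, if some $g$ with components in $\mathcal F_B$ satisfies $g|_B=f|_B$ and $\int\|\omega\|_B\,\|\hat g(\omega)\|_2\,d\omega\le C$; for vector-valued $f$, $\|\hat g(\omega)\|_2$ is the Euclidean norm of the vector $\hat g(\omega)$. We call $f$ *componentwise $C$-Barron on $B$* if each of its (real-valued) components is $C$-Barron on $B$; this is the weaker property. A function $\sigma:\mathbb R\to\mathbb R$ is *sigmoidal* if it is bounded and measurable with $\sigma(x)\to0$ as $x\to-\infty$ and $\sigma(x)\to1$ as $x\to\infty$. A neural network with $l$ hidden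 layers and activation $\sigma$ computes $x^{(0)}=x$, $x^{(i)}=\sigma(A^{(i)}x^{(i-1)}+b^{(i)})$ for $1\le i\le l$ ($\sigma$ applied entrywise), and outputs $A^{(l+1)}x^{(l)}+b^{(l+1)}$; the number of nodes on the $i$th layer is the dimension of $x^{(i)}$. For probability measures $\mu,\nu$ on $\mathbb R^n$, $W_2(\mu,\nu)=\big(\inf_\gamma\int\|x-y\|_2^2\,d\gamma(x,y)\big)^{1/2}$ over all couplings $\gamma$ of $\mu$ and $\nu$. $B_n$ is the closed Euclidean unit ball of $\mathbb R^n$. **Statement.** Let $\varepsilon,s>0$, $l\ge1$, $m_0,\dots,m_l\in\mathbb N$, $f_i:\mathbb R^{m_{i-1}}\to\mathbb R^{m_i}$ for $1\le i\le l$, $C_1,\dots,C_l\in\mathbb R$, $\mu_0$ a probability measure on $\mathbb R^{m_0}$, and $K_i\subseteq\mathbb R^{m_i}$ for $0\le i\le l$ sets, bounded for $i<l$. Suppose that 1. $\operatorname{Supp}(\mu_0)\subseteq K_0$; 2. each $f_i$ is $1$-Lipschitz for the Euclidean norms; 3. $f_1$ is componentwise $C_1$-Barron on $K_0$, and for $2\le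 i\le l$, $f_i$ is componentwise $C_i$-Barron on $K_{i-1}+sB_{m_{i-1}}$; 4. $f_i(K_{i-1})\subseteq K_i$ for $1\le i\le l$. Let $D$ be the diameter of $(f_l\circ\cdots\circ f_1)(K_0)$, let $r_i=\lceil 4C_i^2m_i/\varepsilon^2\rceil$, and let $\sigma$ be any sigmoidal function. (a) If moreover $f_1\in\Gamma_{K_0}(C_1)$ and $f_i\in\Gamma_{K_{i-1}+sB_{m_{i-1}}}(C_i)$ for $2\le i\le l$ (as vector-valued functions), then there is a neural network $g$ with activation $\sigma$ and $l$ hidden layers, with $r_i$ nodes on the $i$th layer, such that, for $X\sim\mu_0$, $$W_2\big(\mathrm{law}\,(f_l\circ\cdots\circ f_1)(X),\ \mathrm{law}\,g(X)\big)\le l\varepsilon\sqrt{1+(2C_l\sqrt{m_l}+D)^2\frac{l}{3s^2}}.$$ (b) Without the additional hypothesis of (a), there is a neural network $g$ with activation $\sigma$ and $l$ hidden layers, with $m_ir_i$ nodes on the $i$th layer ($r_i$ for each coordinate of $f_i$), that satisfies the same inequality. -/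

import Mathlib

open MeasureTheory Filter Topology
open scoped ENNReal Pointwise

noncomputable section

namespace BarronNet

/-- `ℝⁿ` with its Euclidean norm. -/
abbrev Euc (n : ℕ) : Type := EuclideanSpace ℝ (Fin n)

/-- `f 0, f 1, f 2, …` is the chain `f₁, f₂, f₃, …`; `chain f l = f_l ∘ ⋯ ∘ f₁`. -/
def chain {m : ℕ → ℕ} (f : ∀ i, Euc (m i) → Euc (m (i + 1))) : ∀ l, Euc (m 0) → Euc (m l)
  | 0 => id
  | l + 1 => f l ∘ chain f l

/-! ### Fourier transform and Barron functions -/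

/-- The Fourier transform `ĝ(ω) = (2π)⁻ⁿ ∫ g(x) exp(-i⟨ω, x⟩) dx` of `g ∈ L¹(ℝⁿ)`. -/
def fourierT {n : ℕ} (g : Euc n → ℝ) (ω : Euc n) : ℂ :=
  (((2 * Real.pi) ^ n)⁻¹ : ℝ) *
    ∫ x : Euc n, (g x : ℂ) * Complex.exp (-(Complex.I * (inner ℝ ω x : ℝ)))

/-- The Fourier transform of a vector-valued function, taken componentwise. -/
def fourierVec {n m : ℕ} (g : Euc n → Euc m) (ω : Euc n) : EuclideanSpace ℂ (Fin m) :=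
  WithLp.toLp 2 fun j => fourierT (fun x => g x j) ω

/-- `‖ω‖_B = sup_{x ∈ B} |⟨ω, x⟩|`, for a bounded set `B`. -/
def dualNorm {n : ℕ} (B : Set (Euc n)) (ω : Euc n) : ℝ :=
  sSup ((fun x => |(inner ℝ ω x : ℝ)|) '' B)

/-- The class `𝓕_B` of those `g ∈ L¹(ℝⁿ)` for which the Fourier inversion formula holds on `B`
after subtracting `g(0)`. -/
def FourierInversionOn {n : ℕ} (B : Set (Euc n)) (g : Euc n → ℝ) : Prop :=
  Integrable g ∧ ∀ x ∈ B,
    Integrable (fun ω : Euc n =>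
      (Complex.exp (Complex.I * (inner ℝ ω x : ℝ)) - 1) * fourierT g ω) ∧
    (g x : ℂ) = g 0 + ∫ ω : Euc n,
      (Complex.exp (Complex.I * (inner ℝ ω x : ℝ)) - 1) * fourierT g ω

/-- `f|_B ∈ Γ_B(C)` for real-valued `f`: some `g ∈ 𝓕_B` agrees with `f` on `B` and has
`∫ ‖ω‖_B |ĝ(ω)| dω ≤ C`. -/
def IsBarron {n : ℕ} (B : Set (Euc n)) (C : ℝ) (f : Euc n → ℝ) : Prop :=
  ∃ g : Euc n → ℝ, Set.EqOn g f B ∧ FourierInversionOn B g ∧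
    Integrable (fun ω : Euc n => dualNorm B ω * ‖fourierT g ω‖) ∧
    ∫ ω : Euc n, dualNorm B ω * ‖fourierT g ω‖ ≤ C

/-- Each component of `f` is `C`-Barron on `B`. -/
def IsBarronComponentwise {n m : ℕ} (B : Set (Euc n)) (C : ℝ) (f : Euc n → Euc m) : Prop :=
  ∀ j, IsBarron B C fun x => f x j

/-- `f|_B ∈ Γ_B(C)` for vector-valued `f`: as in the real-valued case, with the Fourier transform
taken componentwise and `|ĝ(ω)|` the Euclidean norm of the vector `ĝ(ω)`. -/
def IsBarronVec {n m : ℕ} (B : Set (Euc n)) (C : ℝ) (f : Euc n → Euc m) : Prop :=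
  ∃ g : Euc n → Euc m, Set.EqOn g f B ∧ (∀ j, FourierInversionOn B fun x => g x j) ∧
    Integrable (fun ω : Euc n => dualNorm B ω * ‖fourierVec g ω‖) ∧
    ∫ ω : Euc n, dualNorm B ω * ‖fourierVec g ω‖ ≤ C

/-- The set on which the `(i+1)`-st function of the chain has to be Barron: `K₀` for the first
function, and the neighbourhood `K_i + s B` (`B` the closed unit ball) for the later ones. -/
def barronDomain {m : ℕ → ℕ} (K : ∀ i, Set (Euc (m i))) (s : ℝ) : ∀ i, Set (Euc (m i))
  | 0 => K 0
  | i + 1 => K (i + 1) + s • Metric.closedBall (0 : Euc (m (i + 1))) 1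

/-! ### Neural networks -/

/-- A sigmoidal function. -/
structure IsSigmoidal (σ : ℝ → ℝ) : Prop where
  measurable : Measurable σ
  bounded : ∃ M : ℝ, ∀ x, |σ x| ≤ M
  tendsto_atBot : Tendsto σ atBot (𝓝 0)
  tendsto_atTop : Tendsto σ atTop (𝓝 1)

/-- Sizes of the layers of a network with input dimension `p` whose `i`-th hidden layer,
`i = 1, 2, …`, has `w i` nodes; layer `0` is the input. -/
def layerSize (p : ℕ) (w : ℕ → ℕ) : ℕ → ℕ
  | 0 => p
  | i + 1 => w (i + 1)

/-- The parameters of a feedforward network with input space `ℝᵖ`, output space `ℝ^q` and `l` hidden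
layers of sizes `w 1, …, w l`. -/
structure NeuralNetwork (p q l : ℕ) (w : ℕ → ℕ) where
  /-- weights leading from layer `i` to the hidden layer `i + 1` -/
  A : ∀ i : Fin l, Matrix (Fin (layerSize p w (i + 1))) (Fin (layerSize p w i)) ℝ
  /-- biases of the hidden layer `i + 1` -/
  b : ∀ i : Fin l, Fin (layerSize p w (i + 1)) → ℝ
  /-- weights of the linear output layer -/
  Aout : Matrix (Fin q) (Fin (layerSize p w l)) ℝ
  /-- biases of the linear output layer -/
  bout : Fin q → ℝ

/-- The values `x⁽ⁱ⁾` on layer `i ≤ l` for the input `x`, with activation function `σ`. -/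
def NeuralNetwork.layer {p q l : ℕ} {w : ℕ → ℕ} (N : NeuralNetwork p q l w) (σ : ℝ → ℝ)
    (x : Euc p) : ∀ i, i ≤ l → Fin (layerSize p w i) → ℝ
  | 0, _ => fun k => x k
  | i + 1, h => fun j =>
      σ ((∑ k, N.A ⟨i, h⟩ j k * N.layer σ x i (Nat.le_of_succ_le h) k) + N.b ⟨i, h⟩ j)

/-- The function computed by the network. -/
def NeuralNetwork.eval {p q l : ℕ} {w : ℕ → ℕ} (N : NeuralNetwork p q l w) (σ : ℝ → ℝ)
    (x : Euc p) : Euc q :=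
  WithLp.toLp 2 fun j => (∑ k, N.Aout j k * N.layer σ x l le_rfl k) + N.bout j

/-! ### Wasserstein distance -/

/-- `γ` is a coupling of `μ` and `ν`. -/
def IsCoupling {n : ℕ} (γ : Measure (Euc n × Euc n)) (μ ν : Measure (Euc n)) : Prop :=
  γ.map Prod.fst = μ ∧ γ.map Prod.snd = ν

/-- The Wasserstein distance `W_p(μ, ν) = (inf_γ ∫ ‖x - y‖ᵖ dγ(x, y))^(1/p)`, with values in
`[0, ∞]`. -/
def wasserstein {n : ℕ} (p : ℝ) (μ ν : Measure (Euc n)) : ℝ≥0∞ :=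
  (⨅ (γ : Measure (Euc n × Euc n)) (_ : IsCoupling γ μ ν),
    ∫⁻ z, ENNReal.ofReal (‖z.1 - z.2‖ ^ p) ∂γ) ^ (1 / p)

end BarronNet

end

open BarronNet

/-
Integrating along rays turns Fourier inversion on `B` into the statement that `f` agrees on `B`
with a constant plus an average of functions `y ↦ ±v` switching sign across random hyperplanes, with
`‖v‖ ≤ C`. Sampling `r` of them (Maurey) approximates `f` in `L²` of any probability measure within
`C / √r`, and steep sigmoids approximate the sign functions, so each `f i` has a shallow
approximation whose distance to it is also bounded uniformly.

The shallow networks are chosen one layer at a time, each for the law of the previous output. Since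
the `f i` are `1`-Lipschitz, the `L²` errors add up as long as the network stays within `s` of the
sets `K i`; by Markov's inequality the exceptional set, where it does not, has measure at most the
sum of the `(i ε / s)²`, and on it the final error is controlled by the uniform bound on the last
layer.
-/

namespace BarronNet

theorem eLpNorm_two_le_ofReal {Ω V : Type*} [MeasurableSpace Ω] [NormedAddCommGroup V]
    {ν : Measure Ω} {g : Ω → V} (hg : MemLp g 2 ν) {η : ℝ} (hη : 0 ≤ η)
    (h : ∫ x, ‖g x‖ ^ 2 ∂ν ≤ η ^ 2) : eLpNorm g 2 ν ≤ ENNReal.ofReal η := by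
  rw [hg.eLpNorm_eq_integral_rpow_norm two_ne_zero ENNReal.ofNat_ne_top]
  simp only [ENNReal.toReal_ofNat, Real.rpow_two, ← one_div, ← Real.sqrt_eq_rpow]
  exact ENNReal.ofReal_le_ofReal (Real.sqrt_le_iff.mpr ⟨hη, h⟩)

section Maurey

variable {Θ Ω V : Type*} [MeasurableSpace Θ] [MeasurableSpace Ω] [NormedAddCommGroup V]
  [InnerProductSpace ℝ V] {P : Measure Θ} [IsProbabilityMeasure P]

theorem norm_sub_integral_le {X : Θ → V} {R : ℝ} (hR : ∀ t, ‖X t‖ ≤ R) (t : Θ) :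
    ‖X t - ∫ t', X t' ∂P‖ ≤ R + R :=
  (norm_sub_le _ _).trans <| add_le_add (hR t) <| by
    simpa using norm_integral_le_of_norm_le_const (μ := P) (ae_of_all _ hR)

theorem integral_norm_add_sub_integral_sq_le [CompleteSpace V] {X : Θ → V}
    (hX : AEStronglyMeasurable X P) {R : ℝ} (hR : ∀ t, ‖X t‖ ≤ R) (u : V) :
    ∫ t, ‖u + (X t - ∫ t', X t' ∂P)‖ ^ 2 ∂P ≤ ‖u‖ ^ 2 + R ^ 2 := by
  set e : V := ∫ t, X t ∂P
  have hXi : Integrable X P := .of_bound hX R (ae_of_all _ hR)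
  have hin : Integrable (fun t ↦ ‖u - e‖ ^ 2 + 2 * inner ℝ (u - e) (X t)) P :=
    (integrable_const _).add ((hXi.const_inner _).const_mul 2)
  calc ∫ t, ‖u + (X t - e)‖ ^ 2 ∂P
      ≤ ∫ t, (‖u - e‖ ^ 2 + 2 * inner ℝ (u - e) (X t) + R ^ 2) ∂P := by
        refine integral_mono_of_nonneg (ae_of_all _ fun t ↦ by positivity)
          (hin.add (integrable_const _)) (ae_of_all _ fun t ↦ ?_)
        dsimp only
        rw [show u + (X t - e) = u - e + X t by abel, norm_add_sq_real]
        gcongr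
        exact hR t
    _ = ‖u - e‖ ^ 2 + 2 * inner ℝ (u - e) e + R ^ 2 := by
        rw [integral_add hin (integrable_const _), integral_add (integrable_const _)
          ((hXi.const_inner _).const_mul 2), integral_const_mul, integral_inner hXi]
        simp [e]
    _ ≤ ‖u‖ ^ 2 + R ^ 2 := by
        rw [norm_sub_sq_real, inner_sub_left, real_inner_self_eq_norm_sq]
        linarith [sq_nonneg ‖e‖]

variable (ν : Measure Ω) [IsFiniteMeasure ν] {v : Θ → Ω → V} {R : ℝ}

theorem memLp_sub_integral (hv : StronglyMeasurable (Function.uncurry v))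
    (hR : ∀ t x, ‖v t x‖ ≤ R) (t : Θ) : MemLp (fun x ↦ v t x - ∫ t', v t' x ∂P) 2 ν :=
  .of_bound ((hv.comp_measurable measurable_prodMk_left).sub
    (StronglyMeasurable.integral_prod_left hv)).aestronglyMeasurable (R + R)
    (ae_of_all _ fun x ↦ norm_sub_integral_le (hR · x) t)

variable [CompleteSpace V]

theorem exists_integral_norm_add_sq_le (hv : StronglyMeasurable (Function.uncurry v))
    (hR : ∀ t x, ‖v t x‖ ≤ R) {p : Θ → Prop} (hp : ∀ᵐ t ∂P, p t) {T : Ω → V} (hT : MemLp T 2 ν) :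
    ∃ t, p t ∧ ∫ x, ‖T x + (v t x - ∫ t', v t' x ∂P)‖ ^ 2 ∂ν
      ≤ ∫ x, ‖T x‖ ^ 2 ∂ν + R ^ 2 * ν.real Set.univ := by
  have hΦ : Integrable (fun z : Θ × Ω ↦ ‖T z.2 + (v z.1 z.2 - ∫ t, v t z.2 ∂P)‖ ^ 2)
      (P.prod ν) := by
    have hmean : StronglyMeasurable fun x ↦ ∫ t, v t x ∂P :=
      StronglyMeasurable.integral_prod_left hv
    have hdev : MemLp (fun z : Θ × Ω ↦ v z.1 z.2 - ∫ t, v t z.2 ∂P) 2 (P.prod ν) :=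
      .of_bound (hv.sub (hmean.comp_measurable measurable_snd)).aestronglyMeasurable (R + R)
        (ae_of_all _ fun z ↦ norm_sub_integral_le (hR · z.2) z.1)
    exact ((hT.comp_snd P).add hdev).integrable_norm_pow two_ne_zero
  obtain ⟨t, hpt, ht⟩ := exists_notMem_null_le_integral hΦ.integral_prod_left (ae_iff.mp hp)
  refine ⟨t, not_not.mp hpt, ht.trans ?_⟩
  have hTi : Integrable (fun x ↦ ‖T x‖ ^ 2) ν := (memLp_two_iff_integrable_sq_norm hT.1).mp hT
  rw [integral_integral_swap hΦ]
  calc ∫ x, ∫ t, ‖T x + (v t x - ∫ t', v t' x ∂P)‖ ^ 2 ∂P ∂ν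
      ≤ ∫ x, (‖T x‖ ^ 2 + R ^ 2) ∂ν := by
        refine integral_mono hΦ.integral_prod_right (hTi.add (integrable_const _)) fun x ↦ ?_
        exact integral_norm_add_sub_integral_sq_le
          (hv.comp_measurable measurable_prodMk_right).aestronglyMeasurable (hR · x) (T x)
    _ = ∫ x, ‖T x‖ ^ 2 ∂ν + R ^ 2 * ν.real Set.univ := by
        rw [integral_add hTi (integrable_const _), integral_const, smul_eq_mul, mul_comm]

theorem exists_integral_norm_sum_sub_sq_le (hv : StronglyMeasurable (Function.uncurry v))
    (hR : ∀ t x, ‖v t x‖ ≤ R) {p : Θ → Prop} (hp : ∀ᵐ t ∂P, p t) (r : ℕ) :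
    ∃ t : Fin r → Θ, (∀ k, p (t k)) ∧
      ∫ x, ‖∑ k, (v (t k) x - ∫ t', v t' x ∂P)‖ ^ 2 ∂ν ≤ r * (R ^ 2 * ν.real Set.univ) := by
  induction r with
  | zero => exact ⟨Fin.elim0, fun k ↦ k.elim0, by simp⟩
  | succ r ih =>
    obtain ⟨t, hpt, ht⟩ := ih
    obtain ⟨t₀, hpt₀, ht₀⟩ := exists_integral_norm_add_sq_le ν hv hR hp
      (memLp_finsetSum Finset.univ fun k _ ↦ memLp_sub_integral (P := P) ν hv hR (t k))
    refine ⟨Fin.snoc t t₀, Fin.lastCases (by simpa using hpt₀) (by simpa using hpt), ?_⟩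
    simp only [Fin.sum_univ_castSucc, Fin.snoc_castSucc, Fin.snoc_last]
    push_cast
    linarith

end Maurey

theorem exists_eLpNorm_integral_sub_average_le {Θ Ω V : Type*} [MeasurableSpace Θ]
    [MeasurableSpace Ω] [NormedAddCommGroup V] [InnerProductSpace ℝ V] [CompleteSpace V]
    {P : Measure Θ} [IsProbabilityMeasure P] (ν : Measure Ω) [IsProbabilityMeasure ν]
    {v : Θ → Ω → V} (hv : StronglyMeasurable (Function.uncurry v)) {R : ℝ}
    (hR : ∀ t x, ‖v t x‖ ≤ R) {p : Θ → Prop} (hp : ∀ᵐ t ∂P, p t) {η : ℝ} (hη : 0 ≤ η) {r : ℕ}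
    (hr : R ^ 2 ≤ η ^ 2 * r) :
    ∃ t : Fin r → Θ, (∀ k, p (t k)) ∧
      eLpNorm (fun x ↦ ∫ t', v t' x ∂P - (r : ℝ)⁻¹ • ∑ k, v (t k) x) 2 ν ≤ ENNReal.ofReal η := by
  rcases r.eq_zero_or_pos with rfl | hr0
  · have hR0 : R = 0 := by simpa using hr
    have hv0 : ∀ t x, v t x = 0 := fun t x ↦ norm_le_zero_iff.mp ((hR t x).trans hR0.le)
    exact ⟨Fin.elim0, fun k ↦ k.elim0, by simp [hv0]⟩
  obtain ⟨t, hpt, ht⟩ := exists_integral_norm_sum_sub_sq_le ν hv hR hp r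
  have hrpos : (0 : ℝ) < r := by exact_mod_cast hr0
  have hdev : ∀ x, ∫ t', v t' x ∂P - (r : ℝ)⁻¹ • ∑ k, v (t k) x
      = -(r : ℝ)⁻¹ • ∑ k, (v (t k) x - ∫ t', v t' x ∂P) := fun x ↦ by
    rw [Finset.sum_sub_distrib, Finset.sum_const, Finset.card_univ, Fintype.card_fin,
      ← Nat.cast_smul_eq_nsmul ℝ, smul_sub, smul_smul, neg_mul, inv_mul_cancel₀ hrpos.ne']
    module
  refine ⟨t, hpt, ?_⟩
  simp only [hdev]
  refine eLpNorm_two_le_ofReal ((memLp_finsetSum _ fun k _ ↦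
    memLp_sub_integral ν hv hR (t k)).const_smul _) hη ?_
  simp only [Pi.smul_apply, norm_smul, mul_pow, integral_const_mul, norm_neg, norm_inv,
    Real.norm_natCast]
  calc (r : ℝ)⁻¹ ^ 2 * ∫ x, ‖∑ k, (v (t k) x - ∫ t', v t' x ∂P)‖ ^ 2 ∂ν
      ≤ (r : ℝ)⁻¹ ^ 2 * (r * (η ^ 2 * r)) := by
        gcongr
        refine ht.trans ?_
        rw [probReal_univ, mul_one]
        gcongr
    _ = η ^ 2 := by field_simp

theorem exists_isProbabilityMeasure_integral_smul_eq {Θ V : Type*} [MeasurableSpace Θ]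
    [NormedAddCommGroup V] [NormedSpace ℝ V] (μ : Measure Θ) [SFinite μ] [NeZero μ] {e : Θ → V}
    (he : StronglyMeasurable e) (hei : Integrable e μ) :
    ∃ P : Measure Θ, IsProbabilityMeasure P ∧ P ≪ μ ∧ ∃ d : Θ → V, StronglyMeasurable d ∧
      (∀ t, ‖d t‖ ≤ ∫ t, ‖e t‖ ∂μ) ∧ ∀ φ : Θ → ℝ, ∫ t, φ t • e t ∂μ = ∫ t, φ t • d t ∂P := by
  set I : ℝ := ∫ t, ‖e t‖ ∂μ
  have hI : 0 ≤ I := by positivity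
  rcases hI.eq_or_lt with hI0 | hIpos
  · have he0 : e =ᵐ[μ] 0 := by
      filter_upwards [(integral_eq_zero_iff_of_nonneg (fun t ↦ norm_nonneg (e t)) hei.norm).mp
        hI0.symm] with t ht using norm_eq_zero.mp ht
    refine ⟨μ.toFinite, inferInstance, toFinite_absolutelyContinuous μ, 0, stronglyMeasurable_zero,
      fun t ↦ by simpa using hI, fun φ ↦ ?_⟩
    rw [integral_eq_zero_of_ae (by filter_upwards [he0] with t ht; simp [ht])]
    simp
  set ρ : Θ → NNReal := fun t ↦ ‖e t‖₊ / I.toNNReal with hρ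
  have hρm : Measurable ρ := he.nnnorm.measurable.div_const _
  refine ⟨μ.withDensity fun t ↦ ρ t, ⟨?_⟩, withDensity_absolutelyContinuous _ _,
    fun t ↦ (I / ‖e t‖) • e t, (he.norm.measurable.const_div I).stronglyMeasurable.smul he,
    fun t ↦ ?_, fun φ ↦ ?_⟩
  · rw [withDensity_apply _ .univ, setLIntegral_univ]
    simp only [hρ, ENNReal.coe_div (Real.toNNReal_pos.mpr hIpos).ne']
    simp_rw [div_eq_mul_inv]
    rw [lintegral_mul_const _ he.nnnorm.measurable.coe_nnreal_ennreal]
    have : ∫⁻ t, ‖e t‖₊ ∂μ = I.toNNReal := by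
      exact (ofReal_integral_norm_eq_lintegral_enorm hei).symm
    rw [this, ENNReal.mul_inv_cancel (by simpa using hIpos) ENNReal.coe_ne_top]
  · rw [norm_smul, norm_div, norm_norm, Real.norm_of_nonneg hI]
    rcases eq_or_ne ‖e t‖ 0 with h0 | h0 <;> simp [h0, hI]
  · rw [integral_withDensity_eq_integral_smul hρm]
    refine integral_congr_ae (ae_of_all _ fun t ↦ ?_)
    rcases eq_or_ne (e t) 0 with h0 | h0
    · simp [h0]
    · simp only [hρ, NNReal.smul_def, NNReal.coe_div, coe_nnnorm, Real.coe_toNNReal _ hI, smul_smul]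
      congr 1
      field_simp

theorem intervalIntegral_sign_smul_deriv {E : Type*} [NormedAddCommGroup E] [NormedSpace ℝ E]
    [CompleteSpace E] {G G' : ℝ → E} {a b τ : ℝ} (hτ : τ ∈ Set.Icc a b)
    (hG : ∀ u, HasDerivAt G (G' u) u) (hG' : IntervalIntegrable G' volume a b) :
    ∫ u in a..b, (if u ≤ τ then 1 else -1 : ℝ) • G' u = (2 : ℝ) • G τ - (G a + G b) := by
  have hsplit : ∀ u, (if u ≤ τ then 1 else -1 : ℝ) • G' u
      = (2 : ℝ) • {u | u ≤ τ}.indicator G' u - G' u := fun u ↦ by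
    by_cases hu : u ≤ τ
    · simp [hu, two_smul]
    · simp [hu]
  have hsub : IntervalIntegrable G' volume a τ :=
    hG'.mono_set (Set.uIcc_subset_uIcc_left (Set.Icc_subset_uIcc hτ))
  have hind : IntervalIntegrable ({u | u ≤ τ}.indicator G') volume a b :=
    ⟨hG'.1.indicator measurableSet_Iic, hG'.2.indicator measurableSet_Iic⟩
  have hind2 : IntervalIntegrable (fun u ↦ (2 : ℝ) • {u | u ≤ τ}.indicator G' u) volume a b :=
    hind.smul 2
  simp only [hsplit]
  rw [intervalIntegral.integral_sub hind2 hG', intervalIntegral.integral_smul,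
    intervalIntegral.integral_indicator hτ,
    intervalIntegral.integral_eq_sub_of_hasDerivAt (fun u _ ↦ hG u) hsub,
    intervalIntegral.integral_eq_sub_of_hasDerivAt (fun u _ ↦ hG u) hG']
  module

/-- The step function `±1` across the hyperplane `{y | ⟪θ.1, y⟫ = θ.2}`. -/
noncomputable def halfspaceSign {n : ℕ} (θ : Euc n × ℝ) (y : Euc n) : ℝ :=
  if θ.2 ≤ inner ℝ θ.1 y then 1 else -1

theorem measurable_uncurry_halfspaceSign {n : ℕ} :
    Measurable (Function.uncurry (halfspaceSign (n := n))) :=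
  Measurable.ite (measurableSet_le (by fun_prop) (by fun_prop)) measurable_const measurable_const

theorem abs_halfspaceSign {n : ℕ} (θ : Euc n × ℝ) (y : Euc n) : |halfspaceSign θ y| = 1 := by
  unfold halfspaceSign
  split_ifs <;> simp

/-- `F` is a constant plus an average of step functions across random hyperplanes, with vector
weights of norm at most `C`. Absolute continuity of the law `P` of the hyperplane is what makes
almost every hyperplane a null set for a given measure on the domain. -/
def IsSignMixture {n : ℕ} {V : Type*} [NormedAddCommGroup V] [NormedSpace ℝ V] (C : ℝ)
    (F : Euc n → V) : Prop :=
  ∃ P : Measure (Euc n × ℝ), IsProbabilityMeasure P ∧ P ≪ volume ∧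
    ∃ d : Euc n × ℝ → V, StronglyMeasurable d ∧ (∀ θ, ‖d θ‖ ≤ C) ∧
      ∃ a : V, ∀ y, F y = a + ∫ θ, halfspaceSign θ y • d θ ∂P

theorem integral_halfspaceSign_smul {n : ℕ} {V : Type*} [NormedAddCommGroup V] [NormedSpace ℝ V]
    {e : Euc n × ℝ → V} (he : Integrable e) (x : Euc n) :
    ∫ θ, halfspaceSign θ x • e θ
      = ∫ ω, ∫ u, (if u ≤ inner ℝ ω x then 1 else -1 : ℝ) • e (ω, u) := by
  rw [Measure.volume_eq_prod, integral_prod]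
  · rfl
  · exact he.mono ((measurable_uncurry_halfspaceSign.comp
      measurable_prodMk_right).aestronglyMeasurable.smul he.1)
      (ae_of_all _ fun θ ↦ by simp [norm_smul, abs_halfspaceSign])

section RidgeDensity

variable {n : ℕ} {W V : Type*} [NormedAddCommGroup W] [NormedSpace ℂ W] [NormedAddCommGroup V]
  [NormedSpace ℝ V]

/-- The weight of the step function across `{y | ⟪ω, y⟫ = u}` in the decomposition of
`y ↦ L (exp (i ⟪ω, y⟫) • G ω)`, on the region `|⟪ω, y⟫| ≤ w ω`: half the derivative at `u` of
`u ↦ L (exp (i u) • G ω)`. -/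
noncomputable def ridgeDensity (L : W →L[ℝ] V) (w : Euc n → ℝ) (G : Euc n → W)
    (θ : Euc n × ℝ) : V :=
  (Set.Ioc (-w θ.1) (w θ.1)).indicator
    (fun u : ℝ ↦ (1 / 2 : ℝ) • L ((Complex.exp (Complex.I * u) * Complex.I) • G θ.1)) θ.2

variable {L : W →L[ℝ] V} {w : Euc n → ℝ} {G : Euc n → W}

theorem stronglyMeasurable_ridgeDensity (hw : Measurable w) (hG : StronglyMeasurable G) :
    StronglyMeasurable (ridgeDensity L w G) := by
  have hexp : StronglyMeasurable fun θ : Euc n × ℝ ↦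
      Complex.exp (Complex.I * θ.2) * Complex.I :=
    (by fun_prop : Continuous _).stronglyMeasurable
  have hbody : StronglyMeasurable fun θ : Euc n × ℝ ↦
      (1 / 2 : ℝ) • L ((Complex.exp (Complex.I * θ.2) * Complex.I) • G θ.1) :=
    (L.continuous.comp_stronglyMeasurable
      (hexp.smul (hG.comp_measurable measurable_fst))).const_smul _
  have hset : MeasurableSet {θ : Euc n × ℝ | -w θ.1 < θ.2 ∧ θ.2 ≤ w θ.1} :=
    (measurableSet_lt (hw.comp measurable_fst).neg measurable_snd).inter
      (measurableSet_le measurable_snd (hw.comp measurable_fst))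
  exact hbody.indicator hset

theorem norm_ridgeDensity_le (hL : ‖L‖ ≤ 1) (θ : Euc n × ℝ) :
    ‖ridgeDensity L w G θ‖ ≤
      (Set.Ioc (-w θ.1) (w θ.1)).indicator (fun _ ↦ 1 / 2 * ‖G θ.1‖) θ.2 := by
  rw [ridgeDensity, norm_indicator_eq_indicator_norm]
  refine Set.indicator_le_indicator ?_
  rw [norm_smul, Real.norm_of_nonneg (by norm_num)]
  gcongr
  refine (L.le_of_opNorm_le hL _).trans ?_
  rw [norm_smul, norm_mul, mul_comm Complex.I, Complex.norm_exp_ofReal_mul_I]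
  simp

theorem integrable_ridgeDensity_slice (hw : Measurable w) (hG : StronglyMeasurable G)
    (hL : ‖L‖ ≤ 1) (ω : Euc n) :
    Integrable fun u ↦ ridgeDensity L w G (ω, u) :=
  .mono' (g := (Set.Ioc (-w ω) (w ω)).indicator fun _ ↦ 1 / 2 * ‖G ω‖)
    ((integrableOn_const measure_Ioc_lt_top.ne).integrable_indicator measurableSet_Ioc)
    ((stronglyMeasurable_ridgeDensity hw hG).comp_measurable
      measurable_prodMk_left).aestronglyMeasurable
    (ae_of_all _ fun u ↦ norm_ridgeDensity_le hL (ω, u))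

theorem integral_norm_ridgeDensity_slice_le (hw : Measurable w) (hw₀ : ∀ ω, 0 ≤ w ω)
    (hG : StronglyMeasurable G) (hL : ‖L‖ ≤ 1) (ω : Euc n) :
    ∫ u, ‖ridgeDensity L w G (ω, u)‖ ≤ w ω * ‖G ω‖ := by
  calc ∫ u, ‖ridgeDensity L w G (ω, u)‖
      ≤ ∫ u, (Set.Ioc (-w ω) (w ω)).indicator (fun _ ↦ 1 / 2 * ‖G ω‖) u :=
        integral_mono (integrable_ridgeDensity_slice hw hG hL ω).norm
          ((integrableOn_const measure_Ioc_lt_top.ne).integrable_indicator measurableSet_Ioc)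
          fun u ↦ norm_ridgeDensity_le hL (ω, u)
    _ = w ω * ‖G ω‖ := by
        rw [integral_indicator_const _ measurableSet_Ioc,
          Real.volume_real_Ioc_of_le (by linarith [hw₀ ω]), smul_eq_mul]
        ring

theorem integrable_ridgeDensity (hw : Measurable w) (hw₀ : ∀ ω, 0 ≤ w ω)
    (hG : StronglyMeasurable G) (hL : ‖L‖ ≤ 1) (hwG : Integrable fun ω ↦ w ω * ‖G ω‖) :
    Integrable (ridgeDensity L w G) := by
  have hm := stronglyMeasurable_ridgeDensity (L := L) hw hG
  refine (integrable_prod_iff hm.aestronglyMeasurable).mpr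
    ⟨ae_of_all _ (integrable_ridgeDensity_slice hw hG hL), hwG.mono'
      hm.norm.integral_prod_right'.aestronglyMeasurable (ae_of_all _ fun ω ↦ ?_)⟩
  rw [Real.norm_of_nonneg (by positivity)]
  exact integral_norm_ridgeDensity_slice_le hw hw₀ hG hL ω

theorem integral_norm_ridgeDensity_le (hw : Measurable w) (hw₀ : ∀ ω, 0 ≤ w ω)
    (hG : StronglyMeasurable G) (hL : ‖L‖ ≤ 1) (hwG : Integrable fun ω ↦ w ω * ‖G ω‖) :
    ∫ θ, ‖ridgeDensity L w G θ‖ ≤ ∫ ω, w ω * ‖G ω‖ := by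
  have hi := (integrable_ridgeDensity hw hw₀ hG hL hwG).norm
  rw [Measure.volume_eq_prod, integral_prod _ hi]
  exact integral_mono hi.integral_prod_left hwG
    (integral_norm_ridgeDensity_slice_le hw hw₀ hG hL)

theorem hasDerivAt_map_exp_smul (L : W →L[ℝ] V) (z : W) (u : ℝ) :
    HasDerivAt (fun u : ℝ ↦ L (Complex.exp (Complex.I * u) • z))
      (L ((Complex.exp (Complex.I * u) * Complex.I) • z)) u := by
  have hexp : HasDerivAt (fun u : ℝ ↦ Complex.exp (Complex.I * u))
      (Complex.exp (Complex.I * u) * Complex.I) u := by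
    simpa using ((hasDerivAt_id (u : ℂ)).const_mul Complex.I).cexp.comp_ofReal
  exact L.hasFDerivAt.comp_hasDerivAt u (hexp.smul_const z)

variable [CompleteSpace V]

theorem integral_sign_smul_ridgeDensity {ω : Euc n} {τ : ℝ} (hτ : |τ| ≤ w ω) :
    ∫ u, (if u ≤ τ then 1 else -1 : ℝ) • ridgeDensity L w G (ω, u)
      = L ((Complex.exp (Complex.I * τ) - Real.cos (w ω)) • G ω) := by
  set H : ℝ → V := fun u ↦ (1 / 2 : ℝ) • L (Complex.exp (Complex.I * u) • G ω)
  set H' : ℝ → V := fun u ↦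
    (1 / 2 : ℝ) • L ((Complex.exp (Complex.I * u) * Complex.I) • G ω) with hH'
  have hH'c : Continuous H' := by fun_prop
  have hcos : (Real.cos (w ω) : ℂ) • G ω
      = (1 / 2 : ℝ) • (Complex.exp (Complex.I * (-w ω : ℝ)) • G ω
        + Complex.exp (Complex.I * (w ω : ℝ)) • G ω) := by
    rw [← add_smul, ← Complex.coe_smul, smul_smul, Complex.ofReal_cos, Complex.cos]
    push_cast
    ring_nf
  calc ∫ u, (if u ≤ τ then 1 else -1 : ℝ) • ridgeDensity L w G (ω, u)
      = ∫ u in (-w ω)..w ω, (if u ≤ τ then 1 else -1 : ℝ) • H' u := by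
        rw [intervalIntegral.integral_of_le (by linarith [abs_nonneg τ]),
          ← integral_indicator measurableSet_Ioc]
        refine integral_congr_ae (ae_of_all _ fun u ↦ ?_)
        simp only [ridgeDensity, ← hH', Set.indicator_smul_apply]
    _ = (2 : ℝ) • H τ - (H (-w ω) + H (w ω)) :=
        intervalIntegral_sign_smul_deriv (abs_le.mp hτ)
          (fun u ↦ (hasDerivAt_map_exp_smul L (G ω) u).const_smul _) (hH'c.intervalIntegrable _ _)
    _ = L ((Complex.exp (Complex.I * τ) - Real.cos (w ω)) • G ω) := by
        rw [sub_smul, map_sub, hcos, map_smul L (1 / 2 : ℝ), map_add]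
        module

theorem integrable_smul_of_norm_le {c : Euc n → ℂ} (hc : Measurable c) (hcw : ∀ ω, ‖c ω‖ ≤ w ω)
    (hG : StronglyMeasurable G) (hwG : Integrable fun ω ↦ w ω * ‖G ω‖) :
    Integrable fun ω ↦ c ω • G ω :=
  hwG.mono' (hc.aestronglyMeasurable.smul hG.aestronglyMeasurable) <| ae_of_all _ fun ω ↦ by
    rw [norm_smul]
    gcongr
    exact hcw ω

variable [CompleteSpace W]

theorem exists_isSignMixture_eqOn_of_fourier (hL : ‖L‖ ≤ 1) (hw : Measurable w) (hw₀ : ∀ ω, 0 ≤ w ω)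
    (hG : StronglyMeasurable G) (hwG : Integrable fun ω ↦ w ω * ‖G ω‖) {C : ℝ}
    (hC : ∫ ω, w ω * ‖G ω‖ ≤ C) {B : Set (Euc n)} (hB : ∀ x ∈ B, ∀ ω, |inner ℝ ω x| ≤ w ω)
    {f : Euc n → V} {b : V}
    (hf : ∀ x ∈ B, f x = b + L (∫ ω, (Complex.exp (Complex.I * inner ℝ ω x) - 1) • G ω)) :
    ∃ F, IsSignMixture C F ∧ Set.EqOn f F B := by
  obtain ⟨P, hP, hPac, d, hd, hdC, hPd⟩ := exists_isProbabilityMeasure_integral_smul_eq volume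
    (stronglyMeasurable_ridgeDensity (L := L) hw hG) (integrable_ridgeDensity hw hw₀ hG hL hwG)
  set a : V := b + L (∫ ω, ((Real.cos (w ω) : ℂ) - 1) • G ω)
  refine ⟨fun y ↦ a + ∫ θ, halfspaceSign θ y • d θ ∂P, ⟨P, hP, hPac, d, hd, fun θ ↦
    (hdC θ).trans ((integral_norm_ridgeDensity_le hw hw₀ hG hL hwG).trans hC), a, fun _ ↦ rfl⟩,
    fun x hx ↦ ?_⟩
  have hexp : Integrable fun ω ↦ (Complex.exp (Complex.I * inner ℝ ω x) - 1) • G ω :=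
    integrable_smul_of_norm_le (by fun_prop)
      (fun ω ↦ Real.norm_exp_I_mul_ofReal_sub_one_le.trans (hB x hx ω)) hG hwG
  have hcos : Integrable fun ω ↦ ((Real.cos (w ω) : ℂ) - 1) • G ω :=
    integrable_smul_of_norm_le (by fun_prop) (fun ω ↦ by
      rw [← Complex.ofReal_one, ← Complex.ofReal_sub, Complex.norm_real]
      simpa [abs_of_nonneg (hw₀ ω)] using Real.abs_cos_sub_cos_le (w ω) 0) hG hwG
  have hdiff : Integrable fun ω ↦
      (Complex.exp (Complex.I * inner ℝ ω x) - Real.cos (w ω)) • G ω :=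
    (hexp.sub hcos).congr (ae_of_all _ fun ω ↦ by simp [← sub_smul])
  have hridge : ∫ θ, halfspaceSign θ x • d θ ∂P
      = L (∫ ω, (Complex.exp (Complex.I * inner ℝ ω x) - Real.cos (w ω)) • G ω) := by
    rw [← hPd, integral_halfspaceSign_smul (integrable_ridgeDensity hw hw₀ hG hL hwG),
      ← L.integral_comp_comm hdiff]
    exact integral_congr_ae (ae_of_all _ fun ω ↦ integral_sign_smul_ridgeDensity (hB x hx ω))
  calc f x = b + L (∫ ω, (Complex.exp (Complex.I * inner ℝ ω x) - 1) • G ω) := hf x hx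
    _ = a + ∫ θ, halfspaceSign θ x • d θ ∂P := by
        rw [hridge, add_assoc, ← map_add, ← integral_add hcos]
        · simp only [← add_smul, sub_add_sub_cancel']
        · exact hdiff

end RidgeDensity

section Barron

variable {n m : ℕ} {B : Set (Euc n)} {C : ℝ}

theorem continuous_fourierT {g : Euc n → ℝ} (hg : Integrable g) : Continuous (fourierT g) := by
  refine continuous_const.mul <| continuous_of_dominated (bound := fun x ↦ ‖g x‖) (fun ω ↦ ?_)
    (fun ω ↦ ae_of_all _ fun x ↦ ?_) hg.norm (ae_of_all _ fun x ↦ by fun_prop)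
  · exact (Complex.continuous_ofReal.comp_aestronglyMeasurable hg.1).mul
      (Continuous.aestronglyMeasurable (by fun_prop))
  · rw [norm_mul, ← mul_neg, mul_comm Complex.I, ← Complex.ofReal_neg,
      Complex.norm_exp_ofReal_mul_I]
    simp

theorem continuous_fourierVec {g : Euc n → Euc m} (hg : ∀ j, Integrable fun x ↦ g x j) :
    Continuous (fourierVec g) :=
  (PiLp.continuous_toLp 2 _).comp (continuous_pi fun j ↦ continuous_fourierT (hg j))

theorem bddAbove_abs_inner_image (hB : Bornology.IsBounded B) (ω : Euc n) :
    BddAbove ((fun x ↦ |inner ℝ ω x|) '' B) := by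
  obtain ⟨R, hR⟩ := hB.exists_norm_le
  refine ⟨‖ω‖ * R, ?_⟩
  rintro _ ⟨x, hx, rfl⟩
  exact (abs_real_inner_le_norm _ _).trans (by gcongr; exact hR x hx)

theorem abs_inner_le_dualNorm (hB : Bornology.IsBounded B) {x : Euc n} (hx : x ∈ B) (ω : Euc n) :
    |inner ℝ ω x| ≤ dualNorm B ω :=
  le_csSup (bddAbove_abs_inner_image hB ω) ⟨x, hx, rfl⟩

theorem dualNorm_nonneg (B : Set (Euc n)) (ω : Euc n) : 0 ≤ dualNorm B ω := by
  refine Real.sSup_nonneg ?_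
  rintro _ ⟨x, -, rfl⟩
  exact abs_nonneg _

theorem measurable_dualNorm (hB : Bornology.IsBounded B) : Measurable (dualNorm B) := by
  have hsup : dualNorm B = fun ω ↦ ⨆ x : B, |inner ℝ ω x.1| := funext fun ω ↦ sSup_image'
  rw [hsup]
  refine (lowerSemicontinuous_ciSup (fun ω ↦ ?_) fun x ↦
    Continuous.lowerSemicontinuous (by fun_prop)).measurable
  simpa only [Set.image_eq_range] using bddAbove_abs_inner_image hB ω

theorem IsBarron.exists_isSignMixture_eqOn {f : Euc n → ℝ} (hf : IsBarron B C f)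
    (hB : Bornology.IsBounded B) : ∃ F, IsSignMixture C F ∧ Set.EqOn f F B := by
  obtain ⟨g, hgf, ⟨hgi, hinv⟩, hint, hC⟩ := hf
  refine exists_isSignMixture_eqOn_of_fourier (L := Complex.reCLM) (b := g 0) Complex.reCLM_norm.le
    (measurable_dualNorm hB) (dualNorm_nonneg B) (continuous_fourierT hgi).stronglyMeasurable hint
    hC (fun x hx ω ↦ abs_inner_le_dualNorm hB hx ω) fun x hx ↦ ?_
  rw [← hgf hx]
  simpa using congrArg Complex.re (hinv x hx).2

/-- The coordinatewise real part on `ℂᵐ`. -/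
noncomputable def reVec (m : ℕ) : EuclideanSpace ℂ (Fin m) →L[ℝ] Euc m :=
  LinearMap.mkContinuous
    { toFun := fun z ↦ WithLp.toLp 2 fun j ↦ (z j).re
      map_add' := fun z z' ↦ by ext j; simp
      map_smul' := fun c z ↦ by ext j; simp } 1 fun z ↦ by
    rw [one_mul, EuclideanSpace.norm_eq, EuclideanSpace.norm_eq]
    gcongr with j
    exact Complex.abs_re_le_norm _

theorem norm_reVec_le : ‖reVec m‖ ≤ 1 :=
  LinearMap.mkContinuous_norm_le _ zero_le_one _

theorem reVec_integral_apply {Θ : Type*} [MeasurableSpace Θ] {μ : Measure Θ}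
    {ψ : Θ → EuclideanSpace ℂ (Fin m)} (hψ : ∀ j, Integrable (fun θ ↦ ψ θ j) μ) (j : Fin m) :
    reVec m (∫ θ, ψ θ ∂μ) j = (∫ θ, ψ θ j ∂μ).re := by
  change ((∫ θ, ψ θ ∂μ) j).re = _
  rw [eval_integral_piLp hψ]

theorem IsBarronVec.exists_isSignMixture_eqOn {f : Euc n → Euc m} (hf : IsBarronVec B C f)
    (hB : Bornology.IsBounded B) : ∃ F, IsSignMixture C F ∧ Set.EqOn f F B := by
  obtain ⟨g, hgf, hinv, hint, hC⟩ := hf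
  refine exists_isSignMixture_eqOn_of_fourier (L := reVec m) (b := g 0) norm_reVec_le
    (measurable_dualNorm hB) (dualNorm_nonneg B)
    (continuous_fourierVec fun j ↦ (hinv j).1).stronglyMeasurable hint hC
    (fun x hx ω ↦ abs_inner_le_dualNorm hB hx ω) fun x hx ↦ ?_
  ext j
  rw [← hgf hx, PiLp.add_apply, reVec_integral_apply fun j ↦ ((hinv j).2 x hx).1]
  simpa [fourierVec] using congrArg Complex.re ((hinv j).2 x hx).2

end Barron

section SignNet

variable {n r : ℕ} {ι V : Type*} [Fintype ι] [NormedAddCommGroup V]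

/-- The network with one hidden layer of step functions across the hyperplanes `θ k`, with outer
weights `c k` and output bias `a`. -/
noncomputable def signNet [NormedSpace ℝ V] (θ : ι → Euc n × ℝ) (c : ι → V) (a : V)
    (y : Euc n) : V :=
  a + ∑ k, halfspaceSign (θ k) y • c k

theorem ae_ae_inner_ne (ν : Measure (Euc n)) [SFinite ν] :
    ∀ᵐ θ : Euc n × ℝ, ∀ᵐ y ∂ν, inner ℝ θ.1 y ≠ θ.2 := by
  have hmeas : MeasurableSet {z : (Euc n × ℝ) × Euc n | inner ℝ z.1.1 z.2 ≠ z.1.2} :=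
    (measurableSet_eq_fun (by fun_prop) (by fun_prop)).compl
  rw [Measure.ae_ae_comm hmeas]
  refine ae_of_all _ fun y ↦ ?_
  have hslice : MeasurableSet {θ : Euc n × ℝ | inner ℝ θ.1 y ≠ θ.2} :=
    (measurableSet_eq_fun (by fun_prop) (by fun_prop)).compl
  rw [Measure.volume_eq_prod, Measure.ae_prod_iff_ae_ae hslice]
  exact ae_of_all _ fun ω ↦ by simpa [eq_comm] using Measure.ae_ne volume (inner ℝ ω y)

variable [NormedSpace ℝ V] {C : ℝ} {F : Euc n → V}

theorem IsSignMixture.nonneg (hF : IsSignMixture C F) : 0 ≤ C := by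
  obtain ⟨_, _, -, d, -, hd, -⟩ := hF
  exact (norm_nonneg _).trans (hd 0)

theorem stronglyMeasurable_uncurry_halfspaceSign_smul {d : Euc n × ℝ → V}
    (hd : StronglyMeasurable d) :
    StronglyMeasurable (Function.uncurry fun θ y ↦ halfspaceSign θ y • d θ) :=
  measurable_uncurry_halfspaceSign.stronglyMeasurable.smul (hd.comp_measurable measurable_fst)

theorem IsSignMixture.stronglyMeasurable (hF : IsSignMixture C F) : StronglyMeasurable F := by
  obtain ⟨P, _, -, d, hd, -, a, hFa⟩ := hF
  rw [funext hFa]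
  exact stronglyMeasurable_const.add (StronglyMeasurable.integral_prod_left
    (stronglyMeasurable_uncurry_halfspaceSign_smul hd))

theorem norm_halfspaceSign_smul (θ : Euc n × ℝ) (y : Euc n) (z : V) :
    ‖halfspaceSign θ y • z‖ = ‖z‖ := by
  rw [norm_smul, Real.norm_eq_abs, abs_halfspaceSign, one_mul]

theorem stronglyMeasurable_signNet (θ : ι → Euc n × ℝ) (c : ι → V) (a : V) :
    StronglyMeasurable (signNet θ c a) :=
  stronglyMeasurable_const.add <| Finset.stronglyMeasurable_fun_sum _ fun k _ ↦
    (measurable_uncurry_halfspaceSign.comp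
      measurable_prodMk_left).stronglyMeasurable.smul_const (c k)

end SignNet

theorem IsSignMixture.exists_signNet {n : ℕ} {V : Type*} [NormedAddCommGroup V]
    [InnerProductSpace ℝ V] [CompleteSpace V] {C : ℝ} {F : Euc n → V} (hF : IsSignMixture C F)
    (ν : Measure (Euc n)) [IsProbabilityMeasure ν] {η : ℝ} (hη : 0 ≤ η) {r : ℕ}
    (hr : C ^ 2 ≤ η ^ 2 * r) :
    ∃ (θ : Fin r → Euc n × ℝ) (c : Fin r → V) (a : V),
      (∀ k, ∀ᵐ y ∂ν, inner ℝ (θ k).1 y ≠ (θ k).2) ∧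
      eLpNorm (fun y ↦ F y - signNet θ c a y) 2 ν ≤ ENNReal.ofReal η ∧
      ∀ y z, ‖F y - signNet θ c a z‖ ≤ 2 * C := by
  have hC := hF.nonneg
  obtain ⟨P, hP, hPac, d, hd, hdC, a, hFa⟩ := hF
  have hbound : ∀ θ y, ‖halfspaceSign θ y • d θ‖ ≤ C := fun θ y ↦
    (norm_halfspaceSign_smul θ y (d θ)).trans_le (hdC θ)
  obtain ⟨θ, hθ, hL⟩ := exists_eLpNorm_integral_sub_average_le ν
    (stronglyMeasurable_uncurry_halfspaceSign_smul hd) hbound (hPac.ae_le (ae_ae_inner_ne ν)) hη hr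
  refine ⟨θ, fun k ↦ (r : ℝ)⁻¹ • d (θ k), a, hθ, ?_, fun y z ↦ ?_⟩
  · simpa only [hFa, signNet, add_sub_add_left_eq_sub, Finset.smul_sum, smul_comm (r : ℝ)⁻¹]
      using hL
  · have hmean : ‖∫ θ, halfspaceSign θ y • d θ ∂P‖ ≤ C := by
      simpa using norm_integral_le_of_norm_le_const (μ := P) (ae_of_all _ fun θ ↦ hbound θ y)
    have hnet : ‖∑ k, halfspaceSign (θ k) z • (r : ℝ)⁻¹ • d (θ k)‖ ≤ C := by
      calc ‖∑ k, halfspaceSign (θ k) z • (r : ℝ)⁻¹ • d (θ k)‖ ≤ ∑ _k : Fin r, (r : ℝ)⁻¹ * C :=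
            norm_sum_le_of_le _ fun k _ ↦ by
              rw [norm_halfspaceSign_smul, norm_smul, norm_inv, Real.norm_natCast]
              gcongr
              exact hdC _
        _ = (r : ℝ) * (r : ℝ)⁻¹ * C := by simp [mul_assoc]
        _ ≤ C := mul_le_of_le_one_left hC (mul_inv_le_one)
    rw [hFa, signNet, add_sub_add_left_eq_sub, two_mul]
    exact (norm_sub_le _ _).trans (add_le_add hmean hnet)

theorem tendsto_eLpNorm_sub_of_forall_norm_le {Ω V : Type*} [MeasurableSpace Ω]
    [NormedAddCommGroup V] {ν : Measure Ω} [IsFiniteMeasure ν] {p : ℝ≥0∞} (hp : 1 ≤ p)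
    (hp' : p ≠ ∞) {f : ℕ → Ω → V} {g : Ω → V} (hf : ∀ N, AEStronglyMeasurable (f N) ν)
    (hg : MemLp g p ν) {R : ℝ} (hR : ∀ N x, ‖f N x‖ ≤ R)
    (hlim : ∀ᵐ x ∂ν, Tendsto (f · x) atTop (𝓝 (g x))) :
    Tendsto (fun N ↦ eLpNorm (f N - g) p ν) atTop (𝓝 0) := by
  refine tendsto_Lp_finite_of_tendsto_ae hp hp' hf hg
    (unifIntegrable_of hp hp' hf fun δ _ ↦ ⟨R.toNNReal + 1, fun N ↦ ?_⟩) hlim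
  have hempty : {x | R.toNNReal + 1 ≤ ‖f N x‖₊} = ∅ := by
    ext x
    simpa [← NNReal.coe_lt_coe] using
      (hR N x).trans_lt ((Real.le_coe_toNNReal R).trans_lt (lt_add_one _))
  simp [hempty]

/-- The parameters of a network with input space `ℝⁿ`, one hidden layer of `r` nodes, and output
space `ℝᵐ`. -/
structure ShallowNetwork (n r m : ℕ) where
  /-- weights of the hidden layer -/
  A : Matrix (Fin r) (Fin n) ℝ
  /-- biases of the hidden layer -/
  b : Fin r → ℝ
  /-- weights of the linear output layer -/
  Aout : Matrix (Fin m) (Fin r) ℝ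
  /-- biases of the linear output layer -/
  bout : Fin m → ℝ

namespace ShallowNetwork

variable {n r m : ℕ}

/-- The function computed by the network, with activation function `σ`. -/
noncomputable def eval (N : ShallowNetwork n r m) (σ : ℝ → ℝ) (y : Euc n) : Euc m :=
  WithLp.toLp 2 fun j ↦ (∑ k, N.Aout j k * σ ((∑ i, N.A k i * y i) + N.b k)) + N.bout j

/-- The network that replaces the sign of `t = ⟪ω, y⟫ - u` in `signNet θ c a` by
`2 σ (T t) - 1`. -/
noncomputable def steep (θ : Fin r → Euc n × ℝ) (c : Fin r → Euc m) (a : Euc m) (T : ℝ) :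
    ShallowNetwork n r m where
  A := .of fun k i ↦ T * (θ k).1 i
  b k := -(T * (θ k).2)
  Aout := .of fun j k ↦ 2 * c k j
  bout j := a j - ∑ k, c k j

theorem eval_steep (θ : Fin r → Euc n × ℝ) (c : Fin r → Euc m) (a : Euc m) (T : ℝ) (σ : ℝ → ℝ)
    (y : Euc n) :
    (steep θ c a T).eval σ y
      = a + ∑ k, (2 * σ (T * (inner ℝ (θ k).1 y - (θ k).2)) - 1) • c k := by
  have hpre : ∀ k, (∑ i, T * (θ k).1 i * y i) + -(T * (θ k).2)
      = T * (inner ℝ (θ k).1 y - (θ k).2) := fun k ↦ by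
    rw [PiLp.inner_apply, mul_sub, Finset.mul_sum, sub_eq_add_neg]
    simp [mul_comm, mul_left_comm]
  ext j
  simp only [eval, steep, Matrix.of_apply, hpre, sub_smul, Finset.sum_sub_distrib, PiLp.add_apply,
    PiLp.sub_apply, WithLp.ofLp_sum, Finset.sum_apply, PiLp.smul_apply, smul_eq_mul, one_mul]
  simp only [mul_right_comm]
  ring

theorem measurable_eval (N : ShallowNetwork n r m) {σ : ℝ → ℝ} (hσ : Measurable σ) :
    Measurable (N.eval σ) := by
  unfold eval
  fun_prop

end ShallowNetwork

namespace IsSigmoidal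

variable {n r m : ℕ} {σ : ℝ → ℝ}

theorem tendsto_comp_natCast_mul (hσ : IsSigmoidal σ) {t : ℝ} (ht : t ≠ 0) :
    Tendsto (fun N : ℕ ↦ 2 * σ (N * t) - 1) atTop (𝓝 (if 0 ≤ t then 1 else -1)) := by
  rcases ht.lt_or_gt with ht | ht
  · have := hσ.tendsto_atBot.comp (tendsto_natCast_atTop_atTop.atTop_mul_const_of_neg ht)
    simpa [not_le.mpr ht] using (this.const_mul 2).sub_const 1
  · have := hσ.tendsto_atTop.comp (tendsto_natCast_atTop_atTop.atTop_mul_const ht)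
    have h21 : (2 - 1 : ℝ) = 1 := by norm_num
    simpa [ht.le, h21] using (this.const_mul 2).sub_const 1

theorem tendsto_eval_steep (hσ : IsSigmoidal σ) (θ : Fin r → Euc n × ℝ) (c : Fin r → Euc m)
    (a : Euc m) {y : Euc n} (hy : ∀ k, inner ℝ (θ k).1 y ≠ (θ k).2) :
    Tendsto (fun N : ℕ ↦ (ShallowNetwork.steep θ c a N).eval σ y) atTop
      (𝓝 (signNet θ c a y)) := by
  simp only [ShallowNetwork.eval_steep]
  refine (tendsto_finsetSum _ fun k _ ↦ Tendsto.smul_const ?_ (c k)).const_add a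
  simpa only [halfspaceSign, sub_nonneg] using
    hσ.tendsto_comp_natCast_mul (sub_ne_zero.mpr (hy k))

theorem exists_norm_eval_steep_le (hσ : IsSigmoidal σ) (θ : Fin r → Euc n × ℝ)
    (c : Fin r → Euc m) (a : Euc m) :
    ∃ R, ∀ T y, ‖(ShallowNetwork.steep θ c a T).eval σ y‖ ≤ R := by
  obtain ⟨M, hM⟩ := hσ.bounded
  refine ⟨‖a‖ + ∑ k, (2 * M + 1) * ‖c k‖, fun T y ↦ ?_⟩
  rw [ShallowNetwork.eval_steep]
  refine (norm_add_le _ _).trans (add_le_add le_rfl (norm_sum_le_of_le _ fun k _ ↦ ?_))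
  rw [norm_smul]
  gcongr
  refine (norm_sub_le _ _).trans ?_
  rw [norm_mul, Real.norm_ofNat, norm_one, Real.norm_eq_abs]
  gcongr
  exact hM _

theorem exists_eLpNorm_signNet_sub_eval_le (hσ : IsSigmoidal σ) (ν : Measure (Euc n))
    [IsFiniteMeasure ν] (θ : Fin r → Euc n × ℝ) (c : Fin r → Euc m) (a : Euc m)
    (hθ : ∀ k, ∀ᵐ y ∂ν, inner ℝ (θ k).1 y ≠ (θ k).2) {δ : ℝ} (hδ : 0 < δ) :
    ∃ N : ShallowNetwork n r m,
      eLpNorm (fun y ↦ signNet θ c a y - N.eval σ y) 2 ν ≤ ENNReal.ofReal δ := by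
  obtain ⟨R, hR⟩ := hσ.exists_norm_eval_steep_le θ c a
  have hsign : MemLp (signNet θ c a) 2 ν :=
    .of_bound (stronglyMeasurable_signNet θ c a).aestronglyMeasurable (‖a‖ + ∑ k, ‖c k‖)
      (ae_of_all _ fun y ↦ (norm_add_le _ _).trans (add_le_add le_rfl
        (norm_sum_le_of_le _ fun k _ ↦ (norm_halfspaceSign_smul _ _ _).le)))
  have hmeas : ∀ T : ℕ, AEStronglyMeasurable ((ShallowNetwork.steep θ c a T).eval σ) ν :=
    fun T ↦ (ShallowNetwork.measurable_eval _ hσ.measurable).aestronglyMeasurable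
  have hlim := tendsto_eLpNorm_sub_of_forall_norm_le one_le_two ENNReal.ofNat_ne_top hmeas hsign
    (fun T ↦ hR T) ((ae_all_iff.mpr hθ).mono fun y hy ↦ hσ.tendsto_eval_steep θ c a hy)
  obtain ⟨T, hT⟩ := (hlim.eventually_le_const (ENNReal.ofReal_pos.mpr hδ)).exists
  exact ⟨.steep θ c a T, by rwa [← Pi.sub_def, eLpNorm_sub_comm]⟩

end IsSigmoidal

section Stack

variable {n m : ℕ} {ι κ V : Type*} [Fintype ι] [Fintype κ]

theorem signNet_comp_equiv [NormedAddCommGroup V] [NormedSpace ℝ V] (e : κ ≃ ι)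
    (θ : ι → Euc n × ℝ) (c : ι → V) (a : V) : signNet (θ ∘ e) (c ∘ e) a = signNet θ c a :=
  funext fun y ↦ congrArg (a + ·) (e.sum_comp fun k ↦ halfspaceSign (θ k) y • c k)

theorem signNet_single_apply (θ : Fin m → κ → Euc n × ℝ) (c : Fin m → κ → ℝ) (a : Fin m → ℝ)
    (y : Euc n) (j : Fin m) :
    signNet (fun k : Fin m × κ ↦ θ k.1 k.2) (fun k ↦ EuclideanSpace.single k.1 (c k.1 k.2))
      (WithLp.toLp 2 a) y j = signNet (θ j) (c j) (a j) y := by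
  simp only [signNet, PiLp.add_apply, WithLp.ofLp_sum, Finset.sum_apply, PiLp.smul_apply,
    smul_eq_mul, Fintype.sum_prod_type]
  rw [Finset.sum_eq_single j _ (by simp)]
  · simp
  · exact fun i _ hij ↦ by simp [hij.symm]

theorem norm_le_mul_sqrt_of_forall_norm_le {v : Euc m} {R : ℝ} (hv : ∀ j, ‖v j‖ ≤ R) :
    ‖v‖ ≤ R * √m := by
  rcases m.eq_zero_or_pos with rfl | hm
  · simp [Subsingleton.elim v 0]
  have hR : 0 ≤ R := (norm_nonneg _).trans (hv ⟨0, hm⟩)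
  rw [EuclideanSpace.norm_eq, ← Real.sqrt_sq hR, ← Real.sqrt_mul (sq_nonneg R)]
  gcongr
  calc ∑ j, ‖v j‖ ^ 2 ≤ ∑ _j : Fin m, R ^ 2 := by gcongr with j; exact hv j
    _ = R ^ 2 * m := by simp [mul_comm]

theorem eLpNorm_two_sq {Ω V : Type*} [MeasurableSpace Ω] [NormedAddCommGroup V] (ν : Measure Ω)
    (g : Ω → V) : eLpNorm g 2 ν ^ 2 = ∫⁻ x, ‖g x‖ₑ ^ 2 ∂ν := by
  simpa using eLpNorm_nnreal_pow_eq_lintegral (f := g) (μ := ν) (p := 2) two_ne_zero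

theorem eLpNorm_two_sq_eq_sum {Ω : Type*} [MeasurableSpace Ω] {ν : Measure Ω} {g : Ω → Euc m}
    (hg : Measurable g) : eLpNorm g 2 ν ^ 2 = ∑ j, eLpNorm (fun x ↦ g x j) 2 ν ^ 2 := by
  have hnorm : ∀ v : Euc m, ‖v‖ₑ ^ 2 = ∑ j, ‖v j‖ₑ ^ 2 := fun v ↦ by
    simp_rw [← ofReal_norm, ← ENNReal.ofReal_pow (norm_nonneg _), EuclideanSpace.norm_sq_eq,
      ENNReal.ofReal_sum_of_nonneg fun j (_ : j ∈ Finset.univ) ↦ sq_nonneg ‖v j‖]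
  simp only [eLpNorm_two_sq, hnorm]
  exact lintegral_finsetSum _ fun j _ ↦ by fun_prop

theorem eLpNorm_two_le_mul_sqrt {Ω : Type*} [MeasurableSpace Ω] {ν : Measure Ω} {g : Ω → Euc m}
    (hg : Measurable g) {η : ℝ} (hη : 0 ≤ η)
    (h : ∀ j, eLpNorm (fun x ↦ g x j) 2 ν ≤ ENNReal.ofReal η) :
    eLpNorm g 2 ν ≤ ENNReal.ofReal (η * √m) := by
  rw [← ENNReal.pow_le_pow_left_iff two_ne_zero, eLpNorm_two_sq_eq_sum hg]
  calc ∑ j, eLpNorm (fun x ↦ g x j) 2 ν ^ 2 ≤ ∑ _j : Fin m, ENNReal.ofReal η ^ 2 := by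
        gcongr with j
        exact h j
    _ = ENNReal.ofReal (η * √m) ^ 2 := by
        rw [Finset.sum_const, Finset.card_univ, Fintype.card_fin, ← ENNReal.ofReal_pow hη,
          ← ENNReal.ofReal_nsmul, ← ENNReal.ofReal_pow (by positivity), mul_pow,
          Real.sq_sqrt m.cast_nonneg, nsmul_eq_mul, mul_comm]

end Stack

/-- `f` agrees on `B` with a function that, for every input distribution `ν`, has a measurable
approximation `h` with `L²(ν)`-error at most `η` and uniform error at most `R`, where `h` is an
`L²(ν)`-limit of networks with activation `σ` and one hidden layer of `r` nodes.

The uniform error compares values at two unrelated points: the approximation will be evaluated at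
the output of a network that may have strayed from `B`. -/
def ShallowApproximableOn (σ : ℝ → ℝ) {n m : ℕ} (B : Set (Euc n)) (f : Euc n → Euc m) (r : ℕ)
    (η R : ℝ) : Prop :=
  ∃ F : Euc n → Euc m, Measurable F ∧ Set.EqOn f F B ∧
    ∀ ν : Measure (Euc n), IsProbabilityMeasure ν → ∃ h : Euc n → Euc m, Measurable h ∧
      eLpNorm (fun y ↦ F y - h y) 2 ν ≤ ENNReal.ofReal η ∧ (∀ y z, ‖F y - h z‖ ≤ R) ∧
      ∀ δ : ℝ, 0 < δ → ∃ N : ShallowNetwork n r m,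
        eLpNorm (fun y ↦ h y - N.eval σ y) 2 ν ≤ ENNReal.ofReal δ

section Barron

variable {n m r : ℕ} {B : Set (Euc n)} {C η : ℝ} {f : Euc n → Euc m} {σ : ℝ → ℝ}

theorem IsBarronVec.shallowApproximableOn (hf : IsBarronVec B C f) (hB : Bornology.IsBounded B)
    (hσ : IsSigmoidal σ) (hη : 0 ≤ η) (hr : C ^ 2 ≤ η ^ 2 * r) :
    ShallowApproximableOn σ B f r η (2 * C) := by
  obtain ⟨F, hF, hFf⟩ := hf.exists_isSignMixture_eqOn hB
  refine ⟨F, hF.stronglyMeasurable.measurable, hFf, fun ν _ ↦ ?_⟩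
  obtain ⟨θ, c, a, hθ, hL, hR⟩ := hF.exists_signNet ν hη hr
  exact ⟨signNet θ c a, (stronglyMeasurable_signNet θ c a).measurable, hL, hR,
    fun δ hδ ↦ hσ.exists_eLpNorm_signNet_sub_eval_le ν θ c a hθ hδ⟩

theorem IsBarronComponentwise.shallowApproximableOn (hf : IsBarronComponentwise B C f)
    (hB : Bornology.IsBounded B) (hσ : IsSigmoidal σ) (hη : 0 ≤ η)
    (hr : C ^ 2 * m ≤ η ^ 2 * r) :
    ShallowApproximableOn σ B f (m * r) η (2 * C * √m) := by
  choose F hF hFf using fun j ↦ (hf j).exists_isSignMixture_eqOn hB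
  have hFm : Measurable fun y ↦ (WithLp.toLp 2 fun j ↦ F j y : Euc m) :=
    (PiLp.continuous_toLp 2 _).measurable.comp
      (measurable_pi_lambda _ fun j ↦ (hF j).stronglyMeasurable.measurable)
  refine ⟨fun y ↦ WithLp.toLp 2 fun j ↦ F j y, hFm, fun y hy ↦ ?_, fun ν _ ↦ ?_⟩
  · ext j
    exact hFf j hy
  have hrj : ∀ _j : Fin m, C ^ 2 ≤ (η / √m) ^ 2 * r := fun j ↦ by
    rwa [div_pow, Real.sq_sqrt m.cast_nonneg, div_mul_eq_mul_div,
      le_div_iff₀ (by exact_mod_cast j.pos)]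
  have hηm : η / √m * √m ≤ η := by
    rw [div_mul_eq_mul_div, mul_div_assoc]
    exact mul_le_of_le_one_right hη (div_self_le_one _)
  choose θ c a hθ hL hR using fun j ↦ (hF j).exists_signNet ν (by positivity) (hrj j)
  set Θ : Fin m × Fin r → Euc n × ℝ := fun k ↦ θ k.1 k.2
  set c' : Fin m × Fin r → Euc m := fun k ↦ EuclideanSpace.single k.1 (c k.1 k.2)
  have hcoord : ∀ y j, signNet Θ c' (WithLp.toLp 2 a) y j = signNet (θ j) (c j) (a j) y :=
    signNet_single_apply θ c a
  have hmeas := (stronglyMeasurable_signNet Θ c' (WithLp.toLp 2 a)).measurable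
  refine ⟨signNet Θ c' (WithLp.toLp 2 a), hmeas,
    (eLpNorm_two_le_mul_sqrt (hFm.sub hmeas) (by positivity) fun j ↦ ?_).trans
      (ENNReal.ofReal_le_ofReal hηm),
    fun y z ↦ norm_le_mul_sqrt_of_forall_norm_le fun j ↦ ?_, fun δ hδ ↦ ?_⟩
  · simpa only [Pi.sub_apply, PiLp.sub_apply, hcoord] using hL j
  · simpa only [PiLp.sub_apply, hcoord] using hR j y z
  · rw [← signNet_comp_equiv finProdFinEquiv.symm]
    exact hσ.exists_eLpNorm_signNet_sub_eval_le ν _ _ _ (fun k ↦ hθ _ _) hδ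

end Barron

namespace NeuralNetwork

variable {p q q' l : ℕ} {w : ℕ → ℕ} (N : NeuralNetwork p q l w)
  (S : ShallowNetwork q (w (l + 1)) q') (σ : ℝ → ℝ) (x : Euc p)

/-- The composition of a network with a network with one hidden layer: the output layer of `N`,
being affine, is merged into the hidden layer of `S`. -/
noncomputable def extend : NeuralNetwork p q' (l + 1) w where
  A := Fin.snoc (α := fun i : Fin (l + 1) ↦
    Matrix (Fin (layerSize p w (i + 1))) (Fin (layerSize p w i)) ℝ) N.A (S.A * N.Aout)
  b := Fin.snoc (α := fun i : Fin (l + 1) ↦ Fin (layerSize p w (i + 1)) → ℝ) N.b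
    (S.A.mulVec N.bout + S.b)
  Aout := S.Aout
  bout := S.bout

theorem layer_extend : ∀ i (h : i ≤ l),
    (N.extend S).layer σ x i (h.trans l.le_succ) = N.layer σ x i h
  | 0, _ => rfl
  | i + 1, h => by
    have hA : (N.extend S).A (Fin.castSucc ⟨i, h⟩) = N.A ⟨i, h⟩ :=
      Fin.snoc_castSucc (α := fun i : Fin (l + 1) ↦
        Matrix (Fin (layerSize p w (i + 1))) (Fin (layerSize p w i)) ℝ) _ _ _
    have hb : (N.extend S).b (Fin.castSucc ⟨i, h⟩) = N.b ⟨i, h⟩ :=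
      Fin.snoc_castSucc (α := fun i : Fin (l + 1) ↦ Fin (layerSize p w (i + 1)) → ℝ) _ _ _
    funext j
    rw [layer, layer, layer_extend i (Nat.le_of_succ_le h)]
    exact congrArg₂ (fun A b ↦ σ ((∑ k, A j k * N.layer σ x i _ k) + b j)) hA hb

theorem layer_extend_last (j : Fin (w (l + 1))) :
    (N.extend S).layer σ x (l + 1) le_rfl j
      = σ ((∑ i, S.A j i * N.eval σ x i) + S.b j) := by
  have hA : (N.extend S).A (Fin.last l) = S.A * N.Aout :=
    Fin.snoc_last (α := fun i : Fin (l + 1) ↦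
      Matrix (Fin (layerSize p w (i + 1))) (Fin (layerSize p w i)) ℝ) _ _
  have hb : (N.extend S).b (Fin.last l) = S.A.mulVec N.bout + S.b :=
    Fin.snoc_last (α := fun i : Fin (l + 1) ↦ Fin (layerSize p w (i + 1)) → ℝ) _ _
  have hvec : (S.A * N.Aout).mulVec (N.layer σ x l le_rfl) + (S.A.mulVec N.bout + S.b)
      = S.A.mulVec (N.eval σ x) + S.b := by
    rw [← Matrix.mulVec_mulVec, ← add_assoc, ← Matrix.mulVec_add]
    rfl
  rw [layer, N.layer_extend S σ x l le_rfl]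
  refine (congrArg₂ (fun A b ↦ σ ((∑ k, A j k * N.layer σ x l _ k) + b j)) hA hb).trans ?_
  exact congrArg σ (congrFun hvec j)

theorem eval_extend : (N.extend S).eval σ x = S.eval σ (N.eval σ x) :=
  congrArg (fun v : Fin (w (l + 1)) → ℝ ↦ WithLp.toLp 2 fun j ↦ (∑ k, S.Aout j k * v k) + S.bout j)
    (funext (N.layer_extend_last S σ x))

/-- The network without hidden layers that computes the identity. -/
noncomputable def idNet (p : ℕ) (w : ℕ → ℕ) : NeuralNetwork p p 0 w where
  A i := i.elim0
  b i := i.elim0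
  Aout := (1 : Matrix (Fin p) (Fin p) ℝ)
  bout := 0

theorem eval_idNet (p : ℕ) (w : ℕ → ℕ) (σ : ℝ → ℝ) (x : Euc p) : (idNet p w).eval σ x = x :=
  congrArg (WithLp.toLp 2)
    ((add_zero ((1 : Matrix (Fin p) (Fin p) ℝ).mulVec x)).trans (Matrix.one_mulVec _))

variable {σ}

theorem measurable_layer (hσ : Measurable σ) :
    ∀ i (h : i ≤ l) j, Measurable fun x ↦ N.layer σ x i h j
  | 0, _, j => (EuclideanSpace.proj (𝕜 := ℝ) j).continuous.measurable
  | i + 1, h, j => by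
    have ih := measurable_layer hσ i (Nat.le_of_succ_le h)
    simp only [layer]
    fun_prop

theorem measurable_eval (hσ : Measurable σ) : Measurable (N.eval σ) := by
  have hlayer := N.measurable_layer hσ l le_rfl
  unfold eval
  fun_prop

end NeuralNetwork

section Chain

variable {m : ℕ → ℕ} {f : ∀ i, Euc (m i) → Euc (m (i + 1))} {K : ∀ i, Set (Euc (m i))} {s : ℝ}

theorem continuous_chain {l : ℕ} (hf : ∀ i < l, Continuous (f i)) : Continuous (chain f l) := by
  induction l with
  | zero => exact continuous_id
  | succ l ih => exact (hf l l.lt_succ_self).comp (ih fun i hi ↦ hf i (hi.trans l.lt_succ_self))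

theorem chain_mem {l : ℕ} (hf : ∀ i < l, f i '' K i ⊆ K (i + 1)) {x : Euc (m 0)}
    (hx : x ∈ K 0) : chain f l x ∈ K l := by
  induction l with
  | zero => exact hx
  | succ l ih =>
    exact hf l l.lt_succ_self ⟨_, ih fun i hi ↦ hf i (hi.trans l.lt_succ_self), rfl⟩

theorem mem_barronDomain_succ (hs : 0 ≤ s) {i : ℕ} {x y : Euc (m (i + 1))}
    (hx : x ∈ K (i + 1)) (hxy : ‖x - y‖ ≤ s) : y ∈ barronDomain K s (i + 1) := by
  rw [barronDomain, smul_unitClosedBall_of_nonneg hs]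
  exact ⟨x, hx, y - x, by rwa [mem_closedBall_zero_iff, norm_sub_rev], add_sub_cancel x y⟩

theorem subset_barronDomain (hs : 0 ≤ s) : ∀ i, K i ⊆ barronDomain K s i
  | 0 => subset_rfl
  | _ + 1 => fun x hx ↦ mem_barronDomain_succ hs hx (by simpa using hs)

theorem isBounded_barronDomain {i : ℕ} (hK : Bornology.IsBounded (K i)) :
    Bornology.IsBounded (barronDomain K s i) := by
  cases i with
  | zero => exact hK
  | succ i => exact hK.add (Metric.isBounded_closedBall.smul₀ s)

end Chain

section Wasserstein

variable {Ω : Type*} [MeasurableSpace Ω] {n : ℕ}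

theorem isCoupling_map_prodMk (μ : Measure Ω) {F G : Ω → Euc n} (hF : Measurable F)
    (hG : Measurable G) : IsCoupling (μ.map fun x ↦ (F x, G x)) (μ.map F) (μ.map G) :=
  ⟨Measure.map_map measurable_fst (hF.prodMk hG), Measure.map_map measurable_snd (hF.prodMk hG)⟩

theorem wasserstein_map_le_eLpNorm {p : ℝ} (hp : 0 < p) (μ : Measure Ω) {F G : Ω → Euc n}
    (hF : Measurable F) (hG : Measurable G) :
    wasserstein p (μ.map F) (μ.map G) ≤ eLpNorm (fun x ↦ F x - G x) (ENNReal.ofReal p) μ := by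
  rw [wasserstein, eLpNorm_eq_lintegral_rpow_enorm_toReal (by simpa using hp)
    ENNReal.ofReal_ne_top, ENNReal.toReal_ofReal hp.le]
  refine ENNReal.rpow_le_rpow
    ((iInf₂_le (μ.map fun x ↦ (F x, G x)) (isCoupling_map_prodMk μ hF hG)).trans_eq ?_)
    (by positivity)
  rw [lintegral_map (by fun_prop) (hF.prodMk hG)]
  refine lintegral_congr fun x ↦ ?_
  rw [← ofReal_norm, ENNReal.ofReal_rpow_of_nonneg (norm_nonneg _) hp.le]

end Wasserstein

section Error

variable {Ω V : Type*} [MeasurableSpace Ω] [NormedAddCommGroup V] {μ : Measure Ω}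

theorem eLpNorm_sub_le_ofReal_add {p : ℝ≥0∞} (hp : 1 ≤ p) {F H G : Ω → V}
    (hFH : AEStronglyMeasurable (fun x ↦ F x - H x) μ)
    (hHG : AEStronglyMeasurable (fun x ↦ H x - G x) μ) {a b : ℝ} (ha : 0 ≤ a) (hb : 0 ≤ b)
    (hFHa : eLpNorm (fun x ↦ F x - H x) p μ ≤ ENNReal.ofReal a)
    (hHGb : eLpNorm (fun x ↦ H x - G x) p μ ≤ ENNReal.ofReal b) :
    eLpNorm (fun x ↦ F x - G x) p μ ≤ ENNReal.ofReal (a + b) := by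
  rw [ENNReal.ofReal_add ha hb]
  calc eLpNorm (fun x ↦ F x - G x) p μ
      = eLpNorm ((fun x ↦ F x - H x) + fun x ↦ H x - G x) p μ := by
        congr with x
        exact (sub_add_sub_cancel _ _ _).symm
    _ ≤ _ := (eLpNorm_add_le hFH hHG hp).trans (add_le_add hFHa hHGb)

theorem measure_lt_norm_le_of_eLpNorm_two_le {g : Ω → V} (hg : AEStronglyMeasurable g μ)
    {s a : ℝ} (hs : 0 < s) (ha : 0 ≤ a) (h : eLpNorm g 2 μ ≤ ENNReal.ofReal a) :
    μ {x | s < ‖g x‖} ≤ ENNReal.ofReal ((a / s) ^ 2) := by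
  calc μ {x | s < ‖g x‖} ≤ μ {x | ENNReal.ofReal s ≤ ‖g x‖ₑ} := measure_mono fun x hx ↦ by
        rw [Set.mem_ofPred_eq, ← ofReal_norm]
        exact ENNReal.ofReal_le_ofReal hx.le
    _ ≤ (ENNReal.ofReal s)⁻¹ ^ 2 * eLpNorm g 2 μ ^ 2 := by
        simpa using meas_ge_le_mul_pow_eLpNorm_enorm μ (p := 2) two_ne_zero ENNReal.ofNat_ne_top
          hg (ε := ENNReal.ofReal s) (by simpa using hs) (by simp)
    _ ≤ (ENNReal.ofReal s)⁻¹ ^ 2 * ENNReal.ofReal a ^ 2 := by gcongr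
    _ = ENNReal.ofReal ((a / s) ^ 2) := by
        rw [← mul_pow, ENNReal.ofReal_pow (by positivity), div_eq_inv_mul,
          ENNReal.ofReal_mul (by positivity), ENNReal.ofReal_inv_of_pos hs]

theorem measure_compl_inter_norm_le {g : Ω → V} {S : Set Ω} (hS : MeasurableSet S)
    (hg : AEStronglyMeasurable g (μ.restrict S)) {s a : ℝ} (hs : 0 < s) (ha : 0 ≤ a)
    (h : eLpNorm g 2 (μ.restrict S) ≤ ENNReal.ofReal a) :
    μ (S ∩ {x | ‖g x‖ ≤ s})ᶜ ≤ μ Sᶜ + ENNReal.ofReal ((a / s) ^ 2) := by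
  have hsub : (S ∩ {x | ‖g x‖ ≤ s})ᶜ ⊆ Sᶜ ∪ {x | s < ‖g x‖} ∩ S := fun x hx ↦ by
    by_cases hxS : x ∈ S <;> simp_all
  refine (measure_mono hsub).trans ((measure_union_le _ _).trans ?_)
  gcongr
  rw [← Measure.restrict_apply' hS]
  exact measure_lt_norm_le_of_eLpNorm_two_le hg hs ha h

theorem eLpNorm_two_le_of_restrict_of_ae_norm_le {g : Ω → V} {S : Set Ω} (hS : MeasurableSet S)
    {a b R : ℝ} (ha : 0 ≤ a) (hb : 0 ≤ b) (hR : 0 ≤ R)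
    (hgS : eLpNorm g 2 (μ.restrict S) ≤ ENNReal.ofReal a) (hSb : μ Sᶜ ≤ ENNReal.ofReal b)
    (hgR : ∀ᵐ x ∂μ, ‖g x‖ ≤ R) :
    eLpNorm g 2 μ ≤ ENNReal.ofReal √(a ^ 2 + R ^ 2 * b) := by
  rw [← ENNReal.pow_le_pow_left_iff two_ne_zero, ← ENNReal.ofReal_pow (Real.sqrt_nonneg _),
    Real.sq_sqrt (by positivity), eLpNorm_two_sq, ← lintegral_add_compl _ hS, ← eLpNorm_two_sq,
    ENNReal.ofReal_add (by positivity) (by positivity), ENNReal.ofReal_pow ha]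
  gcongr
  calc ∫⁻ x in Sᶜ, ‖g x‖ₑ ^ 2 ∂μ ≤ ∫⁻ _ in Sᶜ, ENNReal.ofReal (R ^ 2) ∂μ := by
        refine lintegral_mono_ae (ae_restrict_of_ae (hgR.mono fun x hx ↦ ?_))
        rw [← ofReal_norm, ENNReal.ofReal_pow hR]
        gcongr
    _ ≤ ENNReal.ofReal (R ^ 2 * b) := by
        rw [setLIntegral_const, ENNReal.ofReal_mul (by positivity)]
        gcongr

end Error

theorem ShallowApproximableOn.exists_extend {σ : ℝ → ℝ} {p q q' l : ℕ} {w : ℕ → ℕ}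
    {B : Set (Euc q)} {f : Euc q → Euc q'} {η R : ℝ}
    (hf : ShallowApproximableOn σ B f (w (l + 1)) η R) (hη : 0 ≤ η) (hLip : LipschitzWith 1 f)
    (hσ : Measurable σ) (μ : Measure (Euc p)) [IsProbabilityMeasure μ]
    (N : NeuralNetwork p q l w) {F : Euc p → Euc q} (hF : Measurable F) {S : Set (Euc p)}
    (hS : MeasurableSet S) (hNS : ∀ x ∈ S, N.eval σ x ∈ B) {a : ℝ} (ha : 0 ≤ a)
    (hFN : eLpNorm (fun x ↦ F x - N.eval σ x) 2 (μ.restrict S) ≤ ENNReal.ofReal a) :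
    ∃ h : Euc p → Euc q', Measurable h ∧
      eLpNorm (fun x ↦ f (F x) - h x) 2 (μ.restrict S) ≤ ENNReal.ofReal (a + η) ∧
      (∀ y ∈ B, ∀ x, ‖f y - h x‖ ≤ R) ∧
      ∀ δ : ℝ, 0 < δ → ∃ N' : NeuralNetwork p q' (l + 1) w,
        eLpNorm (fun x ↦ h x - N'.eval σ x) 2 μ ≤ ENNReal.ofReal δ := by
  obtain ⟨f', hf'm, hff', hf'⟩ := hf
  have hN := N.measurable_eval hσ
  have hfm := hLip.continuous.measurable
  obtain ⟨h, hh, hL, hR, hδ⟩ :=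
    hf' (μ.map (N.eval σ)) (Measure.isProbabilityMeasure_map hN.aemeasurable)
  have hpull : ∀ g : Euc q → Euc q', Measurable g →
      eLpNorm (fun x ↦ g (N.eval σ x)) 2 μ = eLpNorm g 2 (μ.map (N.eval σ)) := fun g hg ↦
    (eLpNorm_map_measure hg.aestronglyMeasurable hN.aemeasurable).symm
  refine ⟨fun x ↦ h (N.eval σ x), hh.comp hN, ?_, fun y hy x ↦ hff' hy ▸ hR y _, fun δ hδ0 ↦ ?_⟩
  · refine eLpNorm_sub_le_ofReal_add one_le_two (H := fun x ↦ f (N.eval σ x)) (by fun_prop)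
      (by fun_prop) ha hη (le_trans (eLpNorm_mono fun x ↦ ?_) hFN) ?_
    · simpa using hLip.norm_sub_le (F x) (N.eval σ x)
    · calc eLpNorm (fun x ↦ f (N.eval σ x) - h (N.eval σ x)) 2 (μ.restrict S)
          = eLpNorm (fun x ↦ f' (N.eval σ x) - h (N.eval σ x)) 2 (μ.restrict S) :=
            eLpNorm_congr_ae ((ae_restrict_iff' hS).mpr
              (ae_of_all _ fun x hx ↦ by simp only [hff' (hNS x hx)]))
        _ ≤ eLpNorm (fun x ↦ f' (N.eval σ x) - h (N.eval σ x)) 2 μ :=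
            eLpNorm_mono_measure _ Measure.restrict_le_self
        _ ≤ ENNReal.ofReal η := (hpull _ (hf'm.sub hh)).trans_le hL
  · obtain ⟨T, hT⟩ := hδ δ hδ0
    refine ⟨N.extend T, ?_⟩
    simp only [NeuralNetwork.eval_extend]
    exact (hpull _ (hh.sub (T.measurable_eval hσ))).trans_le hT

section Network

variable {m : ℕ → ℕ} {f : ∀ i, Euc (m i) → Euc (m (i + 1))} {K : ∀ i, Set (Euc (m i))}
  {ε η s : ℝ} {μ₀ : Measure (Euc (m 0))} [IsProbabilityMeasure μ₀] {σ : ℝ → ℝ} {w : ℕ → ℕ}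
  {R : ℕ → ℝ}

theorem exists_network_on_large_set (hη : 0 ≤ η) (hηε : η < ε) (hs : 0 < s)
    (hsupp : μ₀.support ⊆ K 0) (hσ : Measurable σ) (l : ℕ)
    (hLip : ∀ i < l, LipschitzWith 1 (f i))
    (hf : ∀ i < l, ShallowApproximableOn σ (barronDomain K s i) (f i) (w (i + 1)) η (R i))
    (hchain : ∀ i < l, f i '' K i ⊆ K (i + 1)) :
    ∃ (N : NeuralNetwork (m 0) (m l) l w) (S : Set (Euc (m 0))), MeasurableSet S ∧
      S ⊆ K 0 ∧ (∀ x ∈ S, N.eval σ x ∈ barronDomain K s l) ∧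
      μ₀ Sᶜ ≤ ENNReal.ofReal ((l + 1) ^ 3 / 3 * (ε / s) ^ 2) ∧
      eLpNorm (fun x ↦ chain f l x - N.eval σ x) 2 (μ₀.restrict S) ≤ ENNReal.ofReal (l * ε) := by
  have hε : 0 < ε := hη.trans_lt hηε
  induction l with
  | zero =>
    refine ⟨.idNet (m 0) w, μ₀.support, Measure.isClosed_support.measurableSet, hsupp,
      fun x hx ↦ ?_, ?_, ?_⟩
    · rw [NeuralNetwork.eval_idNet]
      exact hsupp hx
    · simp
    · simp [NeuralNetwork.eval_idNet, chain]
  | succ l ih =>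
    have hlt : ∀ {i}, i < l → i < l + 1 := fun hi ↦ hi.trans l.lt_succ_self
    obtain ⟨N, S, hS, hSK, hNS, hSμ, hFN⟩ := ih (fun i hi ↦ hLip i (hlt hi))
      (fun i hi ↦ hf i (hlt hi)) fun i hi ↦ hchain i (hlt hi)
    have hF : Measurable (chain f l) :=
      (continuous_chain fun i hi ↦ (hLip i (hlt hi)).continuous).measurable
    have hF' : Measurable (chain f (l + 1)) :=
      (continuous_chain fun i hi ↦ (hLip i hi).continuous).measurable
    obtain ⟨h, hh, hL, -, hδ⟩ := (hf l l.lt_succ_self).exists_extend hη (hLip l l.lt_succ_self) hσ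
      μ₀ N hF hS hNS (by positivity) hFN
    obtain ⟨N', hN'⟩ := hδ (ε - η) (sub_pos.mpr hηε)
    have hN'm := N'.measurable_eval hσ
    have herr : eLpNorm (fun x ↦ chain f (l + 1) x - N'.eval σ x) 2 (μ₀.restrict S)
        ≤ ENNReal.ofReal ((l + 1) * ε) := by
      rw [show (l + 1) * ε = l * ε + η + (ε - η) by ring]
      exact eLpNorm_sub_le_ofReal_add one_le_two (hF'.sub hh).aestronglyMeasurable (by fun_prop)
        (by positivity) (sub_nonneg.mpr hηε.le) hL
        ((eLpNorm_mono_measure _ Measure.restrict_le_self).trans hN')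
    refine ⟨N', S ∩ {x | ‖chain f (l + 1) x - N'.eval σ x‖ ≤ s},
      hS.inter (measurableSet_le (by fun_prop) measurable_const), Set.inter_subset_left.trans hSK,
      fun x hx ↦ mem_barronDomain_succ hs.le (chain_mem hchain (hSK hx.1)) hx.2, ?_, ?_⟩
    · refine (measure_compl_inter_norm_le hS (by fun_prop) hs (by positivity) herr).trans
        ((add_le_add_left hSμ _).trans ?_)
      rw [← ENNReal.ofReal_add (by positivity) (by positivity), mul_div_assoc, mul_pow, ← add_mul]
      gcongr
      push_cast
      nlinarith [l.cast_nonneg (α := ℝ)]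
    · exact (eLpNorm_mono_measure _ (Measure.restrict_mono Set.inter_subset_left le_rfl)).trans
        (by exact_mod_cast herr)

theorem sq_add_exceptional_lt (hη : 0 ≤ η) (hηε : η < ε) (s R : ℝ) {l : ℝ} (hl : 0 ≤ l) :
    (l * ε + η) ^ 2 + R ^ 2 * ((l + 1) ^ 3 / 3 * (ε / s) ^ 2)
      < ((l + 1) * ε * √(1 + R ^ 2 * ((l + 1) / (3 * s ^ 2)))) ^ 2 := by
  have hε : 0 < ε := hη.trans_lt hηε
  rw [mul_pow _ √_, Real.sq_sqrt (by positivity)]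
  calc (l * ε + η) ^ 2 + R ^ 2 * ((l + 1) ^ 3 / 3 * (ε / s) ^ 2)
      < (l * ε + ε) ^ 2 + R ^ 2 * ((l + 1) ^ 3 / 3 * (ε / s) ^ 2) := by gcongr
    _ = ((l + 1) * ε) ^ 2 * (1 + R ^ 2 * ((l + 1) / (3 * s ^ 2))) := by ring

theorem exists_network_wasserstein_le (hη : 0 ≤ η) (hηε : η < ε) (hs : 0 < s)
    (hsupp : μ₀.support ⊆ K 0) (hσ : Measurable σ) (l : ℕ)
    (hLip : ∀ i < l + 1, LipschitzWith 1 (f i))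
    (hf : ∀ i < l + 1, ShallowApproximableOn σ (barronDomain K s i) (f i) (w (i + 1)) η (R i))
    (hchain : ∀ i < l + 1, f i '' K i ⊆ K (i + 1)) :
    ∃ N : NeuralNetwork (m 0) (m (l + 1)) (l + 1) w,
      wasserstein 2 (μ₀.map (chain f (l + 1))) (μ₀.map (N.eval σ)) ≤
        ENNReal.ofReal ((l + 1) * ε * √(1 + R l ^ 2 * ((l + 1) / (3 * s ^ 2)))) := by
  have hε : 0 < ε := hη.trans_lt hηε
  have hlt : ∀ {i}, i < l → i < l + 1 := fun hi ↦ hi.trans l.lt_succ_self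
  obtain ⟨N, S, hS, -, hNS, hSμ, hFN⟩ := exists_network_on_large_set hη hηε hs hsupp hσ l
    (fun i hi ↦ hLip i (hlt hi)) (fun i hi ↦ hf i (hlt hi)) fun i hi ↦ hchain i (hlt hi)
  have hF : Measurable (chain f l) :=
    (continuous_chain fun i hi ↦ (hLip i (hlt hi)).continuous).measurable
  have hF' : Measurable (chain f (l + 1)) :=
    (continuous_chain fun i hi ↦ (hLip i hi).continuous).measurable
  obtain ⟨h, hh, hL, hR, hδ⟩ := (hf l l.lt_succ_self).exists_extend hη (hLip l l.lt_succ_self) hσ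
    μ₀ N hF hS hNS (by positivity) hFN
  have hsup : ∀ᵐ x ∂μ₀, ‖chain f (l + 1) x - h x‖ ≤ R l := by
    filter_upwards [Measure.support_mem_ae (μ := μ₀)] with x hx
    exact hR _ (subset_barronDomain hs.le l
      (chain_mem (fun i hi ↦ hchain i (hlt hi)) (hsupp hx))) x
  obtain ⟨x₀, hx₀⟩ := hsup.exists
  set V : ℝ := (l * ε + η) ^ 2 + R l ^ 2 * ((l + 1) ^ 3 / 3 * (ε / s) ^ 2)
  set T : ℝ := (l + 1) * ε * √(1 + R l ^ 2 * ((l + 1) / (3 * s ^ 2)))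
  have hmain : eLpNorm (fun x ↦ chain f (l + 1) x - h x) 2 μ₀ ≤ ENNReal.ofReal √V :=
    eLpNorm_two_le_of_restrict_of_ae_norm_le hS (by positivity) (by positivity)
      ((norm_nonneg _).trans hx₀) hL hSμ hsup
  have hVT : √V < T := (Real.sqrt_lt' (by positivity)).mpr
    (sq_add_exceptional_lt hη hηε s (R l) l.cast_nonneg)
  obtain ⟨N', hN'⟩ := hδ (T - √V) (sub_pos.mpr hVT)
  have hN'm := N'.measurable_eval hσ
  refine ⟨N', (wasserstein_map_le_eLpNorm two_pos μ₀ hF' hN'm).trans ?_⟩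
  rw [ENNReal.ofReal_ofNat, ← add_sub_cancel √V T]
  exact eLpNorm_sub_le_ofReal_add one_le_two (by fun_prop) (by fun_prop) (Real.sqrt_nonneg V)
    (sub_nonneg.mpr hVT.le) hmain hN'

end Network

section Constants

variable {n m : ℕ} {B : Set (Euc n)} {C : ℝ} {f : Euc n → Euc m}

theorem IsBarronComponentwise.mul_sqrt_nonneg (hf : IsBarronComponentwise B C f) :
    0 ≤ C * √m := by
  rcases m.eq_zero_or_pos with rfl | hm
  · simp
  obtain ⟨_, -, -, -, hC⟩ := hf ⟨0, hm⟩
  have hC0 : 0 ≤ C := (integral_nonneg fun ω ↦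
    mul_nonneg (dualNorm_nonneg B ω) (norm_nonneg _)).trans hC
  positivity

theorem IsBarronVec.mul_sqrt (hf : IsBarronVec B C f) : IsBarronVec B (C * √m) f := by
  obtain ⟨g, hgf, hg, hint, hC⟩ := hf
  refine ⟨g, hgf, hg, hint, ?_⟩
  rcases m.eq_zero_or_pos with rfl | hm
  · simp [Subsingleton.elim (fourierVec g _) 0]
  have hC0 : 0 ≤ C := (integral_nonneg fun ω ↦
    mul_nonneg (dualNorm_nonneg B ω) (norm_nonneg _)).trans hC
  exact hC.trans (le_mul_of_one_le_right hC0 (Real.one_le_sqrt.mpr (by exact_mod_cast hm)))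

end Constants

theorem le_sq_mul_ceil_div_sq {ε : ℝ} (hε : ε ≠ 0) (x : ℝ) : x ≤ ε ^ 2 * ⌈x / ε ^ 2⌉₊ := by
  calc x = ε ^ 2 * (x / ε ^ 2) := by field_simp
    _ ≤ ε ^ 2 * ⌈x / ε ^ 2⌉₊ := by gcongr; exact Nat.le_ceil _

theorem ofReal_mul_sqrt_le_of_le {a c R R' : ℝ} (ha : 0 ≤ a) (hc : 0 ≤ c) (hR : 0 ≤ R)
    (hRR' : R ≤ R') :
    ENNReal.ofReal (a * √(1 + R ^ 2 * c)) ≤ ENNReal.ofReal (a * √(1 + R' ^ 2 * c)) := by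
  gcongr

end BarronNet

theorem corollary3p3_general (l : ℕ) (hl : 1 ≤ l) (ε s : ℝ) (hε : 0 < ε) (hs : 0 < s)
    (m : ℕ → ℕ) (f : ∀ i, Euc (m i) → Euc (m (i + 1)))
    (K : ∀ i, Set (Euc (m i))) (C : ℕ → ℝ) (w : ℕ → ℕ)
    (μ₀ : Measure (Euc (m 0))) [IsProbabilityMeasure μ₀]
    (hK : ∀ i < l, Bornology.IsBounded (K i))
    (hsupp : μ₀.support ⊆ K 0)
    (hLip : ∀ i < l, LipschitzWith 1 (f i))
    (hchain : ∀ i < l, f i '' K i ⊆ K (i + 1))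
    (σ : ℝ → ℝ) (hσ : IsSigmoidal σ) :
    ((∀ i < l, IsBarronVec (barronDomain K s i) (C (i + 1)) (f i)) →
      (∀ i < l, 4 * C (i + 1) ^ 2 ≤ ε ^ 2 * w (i + 1)) →
      ∃ g : NeuralNetwork (m 0) (m l) l w,
        wasserstein 2 (μ₀.map (chain f l)) (μ₀.map (g.eval σ)) ≤
          ENNReal.ofReal (l * ε * √(1 + (2 * C l) ^ 2 * (l / (3 * s ^ 2))))) ∧
    ((∀ i < l, IsBarronComponentwise (barronDomain K s i) (C (i + 1)) (f i)) →
      (∀ i < l, 4 * C (i + 1) ^ 2 * m (i + 1) ≤ ε ^ 2 * w (i + 1)) →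
      ∃ g : NeuralNetwork (m 0) (m l) l (fun i ↦ m i * w i),
        wasserstein 2 (μ₀.map (chain f l)) (μ₀.map (g.eval σ)) ≤
          ENNReal.ofReal (l * ε * √(1 + (2 * C l * √(m l)) ^ 2 * (l / (3 * s ^ 2))))) := by
  obtain ⟨l, rfl⟩ := Nat.exists_eq_add_of_le' hl
  have hB : ∀ i < l + 1, Bornology.IsBounded (barronDomain K s i) := fun i hi ↦
    isBounded_barronDomain (hK i hi)
  push_cast
  refine ⟨fun hf hw ↦ ?_, fun hf hw ↦ ?_⟩
  · refine exists_network_wasserstein_le (η := ε / 2) (R := fun i ↦ 2 * C (i + 1)) (by positivity)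
      (half_lt_self hε) hs hsupp hσ.measurable l hLip (fun i hi ↦ ?_) hchain
    exact (hf i hi).shallowApproximableOn (hB i hi) hσ (by positivity) (by linarith [hw i hi])
  · refine exists_network_wasserstein_le (η := ε / 2) (R := fun i ↦ 2 * C (i + 1) * √(m (i + 1)))
      (by positivity) (half_lt_self hε) hs hsupp hσ.measurable l hLip (fun i hi ↦ ?_) hchain
    exact (hf i hi).shallowApproximableOn (hB i hi) hσ (by positivity) (by linarith [hw i hi])

theorem corollary3p3
    (l : ℕ) (hl : 1 ≤ l) (ε s : ℝ) (hε : 0 < ε) (hs : 0 < s)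
    (m : ℕ → ℕ) (f : ∀ i, Euc (m i) → Euc (m (i + 1)))
    (K : ∀ i, Set (Euc (m i))) (C : ℕ → ℝ)
    (μ₀ : Measure (Euc (m 0))) [IsProbabilityMeasure μ₀]
    (hK : ∀ i < l, Bornology.IsBounded (K i))
    (hsupp : μ₀.support ⊆ K 0)
    (hLip : ∀ i < l, LipschitzWith 1 (f i))
    (hBarron : ∀ i < l, IsBarronComponentwise (barronDomain K s i) (C (i + 1)) (f i))
    (hchain : ∀ i < l, f i '' K i ⊆ K (i + 1))
    (σ : ℝ → ℝ) (hσ : IsSigmoidal σ) :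
    ((∀ i < l, IsBarronVec (barronDomain K s i) (C (i + 1)) (f i)) →
      ∃ g : NeuralNetwork (m 0) (m l) l (fun i => ⌈4 * C i ^ 2 * m i / ε ^ 2⌉₊),
        wasserstein 2 (μ₀.map (chain f l)) (μ₀.map (g.eval σ)) ≤
          ENNReal.ofReal (l * ε * √(1 +
            (2 * C l * √(m l) + Metric.diam (chain f l '' K 0)) ^ 2 * (l / (3 * s ^ 2))))) ∧
    ∃ g : NeuralNetwork (m 0) (m l) l (fun i => m i * ⌈4 * C i ^ 2 * m i / ε ^ 2⌉₊),
      wasserstein 2 (μ₀.map (chain f l)) (μ₀.map (g.eval σ)) ≤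
        ENNReal.ofReal (l * ε * √(1 +
          (2 * C l * √(m l) + Metric.diam (chain f l '' K 0)) ^ 2 * (l / (3 * s ^ 2)))) := by
  have hr : ∀ i, 4 * C i ^ 2 * m i ≤ ε ^ 2 * ⌈4 * C i ^ 2 * m i / ε ^ 2⌉₊ := fun i ↦
    le_sq_mul_ceil_div_sq hε.ne' _
  have hR : 0 ≤ 2 * C l * √(m l) := by
    obtain ⟨k, rfl⟩ := Nat.exists_eq_add_of_le' hl
    linarith [(hBarron k k.lt_succ_self).mul_sqrt_nonneg]
  have hD : ENNReal.ofReal (l * ε * √(1 + (2 * C l * √(m l)) ^ 2 * (l / (3 * s ^ 2)))) ≤ _ :=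
    ofReal_mul_sqrt_le_of_le (by positivity) (by positivity) hR
      (le_add_of_nonneg_right (Metric.diam_nonneg (s := chain f l '' K 0)))
  refine ⟨fun hVec ↦ ?_, ?_⟩
  · obtain ⟨g, hg⟩ := (corollary3p3_general l hl ε s hε hs m f K (fun i ↦ C i * √(m i))
      (fun i ↦ ⌈4 * C i ^ 2 * m i / ε ^ 2⌉₊) μ₀ hK hsupp hLip hchain σ hσ).1
      (fun i hi ↦ (hVec i hi).mul_sqrt) fun i _ ↦
        (by simp [mul_pow, mul_assoc] : _ = _).trans_le (hr (i + 1))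
    exact ⟨g, hg.trans (by simpa only [mul_assoc] using hD)⟩
  · obtain ⟨g, hg⟩ := (corollary3p3_general l hl ε s hε hs m f K C
      (fun i ↦ ⌈4 * C i ^ 2 * m i / ε ^ 2⌉₊) μ₀ hK hsupp hLip hchain σ hσ).2 hBarron
        fun i _ ↦ hr (i + 1)
    exact ⟨g, hg.trans hD⟩
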